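/- Let $K\subset S^3$ be a torus knot, i.e. the image of a standard curve $\theta\mapsto (e^{ip\theta},e^{iq\theta})/\sqrt2$ ($p,q\ge 1$ coprime) in the unit sphere $S^3\subset\mathbb C^2$ under a homeomorphism of $S^3$. Let $\pi=\pi_1(S^3\setminus K)$ be its group and let $\epsilon:\pi\to\mathbb Z$ be the abelianization homomorphism determined by an identification of $\pi/[\pi,\pi]$ with $\mathbb Z$ (an orientation of $K$). Let $\gamma:\pi\to \mathrm{GL}_N\mathbb Z$ be a permutation representation, i.e. a homomorphism all of whose values are permutation matrices (so that its image is finite). Let $\Lambda=\mathbb Z[t^{\pm1}]$, let $V=\mathbb Z^N$ be the module of row vectors, and let $\pi$ act on $\Lambda\otimes_{\mathbb Z} V$ from the right by $(p\otimes v)\cdot g = p\,t^{\epsilon(g)}\otimes v\gamma(g)$. Let $H=H_1(\pi;\Lambda\otimes V)$; this is the first $\gamma$-twisted homology module $H_1(X';V_\gamma)$ of the universal abelian cover $X'$ of the exterior of $K$. A $\gamma$-twisted Alexander polynomial $\Delta_{K,\gamma}\in\Lambda$ is a greatest common divisor of the determinants of the maximal square submatrices ($n\times n$, where $n$ is the number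 of generators) of a finite presentation matrix of the $\Lambda$-module $H$. Then a $\gamma$-twisted Alexander polynomial exists, and every $\gamma$-twisted Alexander polynomial $\Delta_{K,\gamma}$ is, up to multiplication by a unit $\pm t^i$ of $\Lambda$, a finite (possibly empty) product of cyclotomic polynomials. In particular it is nonzero. -/

import Mathlib

open scoped LaurentPolynomial

noncomputable section

/-- The unit sphere `S³` of `ℂ²`. -/
abbrev S3 : Type := Metric.sphere (0 : EuclideanSpace ℂ (Fin 2)) 1

/-- The standard `(p, q)`-torus knot: the curve `θ ↦ (e^{ipθ}, e^{iqθ}) / √2` on the standard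
(unknotted) torus `|z| = |w| = 1 / √2` in `S³`. -/
def standardTorusKnot (p q : ℕ) : Set S3 :=
  {x | ∃ θ : ℝ,
    (x : EuclideanSpace ℂ (Fin 2)) 0 = Complex.exp (p * θ * Complex.I) / (Real.sqrt 2 : ℂ) ∧
    (x : EuclideanSpace ℂ (Fin 2)) 1 = Complex.exp (q * θ * Complex.I) / (Real.sqrt 2 : ℂ)}

/-- A torus knot is a subset of `S³` that a homeomorphism of `S³` carries to a standard torus knot
`T(p, q)` with `p, q` positive and coprime.  Homeomorphisms may reverse the orientation of `S³`, so
mirror images (the knots `T(p, -q)`) are included, and so is the trivial knot `T(1, q)`. -/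
def IsTorusKnot (K : Set S3) : Prop :=
  ∃ p q : ℕ, 0 < p ∧ 0 < q ∧ p.Coprime q ∧ ∃ h : S3 ≃ₜ S3, K = h '' standardTorusKnot p q

/-- The group `π₁(S³ ∖ K, x₀)` of a knot `K`. -/
abbrev KnotGroup (K : Set S3) (x₀ : (Kᶜ : Set S3)) : Type :=
  FundamentalGroup (Kᶜ : Set S3) x₀

section Twisted

variable {π : Type} [Group π] {N : ℕ}

/-- A homomorphism to `GL_N ℤ` is a permutation representation if all its values are permutation
matrices. -/
def IsPermutationRepresentation (γ : π →* GL (Fin N) ℤ) : Prop :=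
  ∀ g : π, ∃ σ : Equiv.Perm (Fin N), (γ g : Matrix (Fin N) (Fin N) ℤ) = σ.permMatrix ℤ

/-- The matrix `t^{ε(g)} γ(g)` over `ℤ[t, t⁻¹]`. -/
def twistedMatrix (γ : π →* GL (Fin N) ℤ) (ε : π →* Multiplicative ℤ) (g : π) :
    Matrix (Fin N) (Fin N) ℤ[T;T⁻¹] :=
  LaurentPolynomial.T (R := ℤ) (ε g).toAdd •
    (γ g : Matrix (Fin N) (Fin N) ℤ).map (LaurentPolynomial.C : ℤ →+* ℤ[T;T⁻¹])

theorem twistedMatrix_one (γ : π →* GL (Fin N) ℤ) (ε : π →* Multiplicative ℤ) :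
    twistedMatrix γ ε 1 = 1 := by
  simp [twistedMatrix]

theorem twistedMatrix_mul (γ : π →* GL (Fin N) ℤ) (ε : π →* Multiplicative ℤ) (g h : π) :
    twistedMatrix γ ε (g * h) = twistedMatrix γ ε g * twistedMatrix γ ε h := by
  simp only [twistedMatrix, map_mul, toAdd_mul, LaurentPolynomial.T_add, Units.val_mul,
    Matrix.map_mul, Matrix.smul_mul, Matrix.mul_smul, smul_smul]
  rw [mul_comm (LaurentPolynomial.T _)]

/-- The module `ℤ[t, t⁻¹] ⊗ ℤ^N` of row vectors, with the right action
`(p ⊗ v) · g = p t^{ε(g)} ⊗ v γ(g)` of `π`, regarded as a left `π`-module through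
`g • m = m · g⁻¹`. -/
def twistedRepresentation (γ : π →* GL (Fin N) ℤ) (ε : π →* Multiplicative ℤ) :
    Representation ℤ[T;T⁻¹] π (Fin N → ℤ[T;T⁻¹]) where
  toFun g := (twistedMatrix γ ε g⁻¹).vecMulLinear
  map_one' := by
    ext1; simp [twistedMatrix_one, Matrix.vecMulLinear, LinearMap.ext_iff]
  map_mul' g h := by
    refine LinearMap.ext fun v => ?_
    simp [twistedMatrix_mul, Matrix.vecMulLinear, Matrix.vecMul_vecMul]

/-- The twisted homology module `H₁(π; ℤ[t, t⁻¹] ⊗ ℤ^N)` over `ℤ[t, t⁻¹]`.  For `π` the group of a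
knot this is the first homology of the knot exterior with the same local coefficients, since the
first homology of a path-connected space with local coefficients is that of its fundamental
group. -/
abbrev TwistedH1 (γ : π →* GL (Fin N) ℤ) (ε : π →* Multiplicative ℤ) :
    ModuleCat ℤ[T;T⁻¹] :=
  groupHomology.H1 (Rep.of (twistedRepresentation γ ε))

end Twisted

section OrderIdeal

variable {R : Type*} [CommRing R]

/-- `A` is a presentation matrix of `M`: the columns of `A` are indexed by generators of `M`, and
its rows generate the module of relations between them. -/
def IsPresentationMatrix {m n : ℕ} (A : Matrix (Fin m) (Fin n) R) (M : Type*) [AddCommGroup M]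
    [Module R M] : Prop :=
  ∃ φ : (Fin n → R) →ₗ[R] M, Function.Surjective φ ∧
    LinearMap.ker φ = Submodule.span R (Set.range A.row)

/-- The determinants of the `n × n` submatrices of a matrix with `n` columns.  (Selections of rows
with a repetition only contribute `0`.) -/
def maximalMinors {m n : ℕ} (A : Matrix (Fin m) (Fin n) R) : Set R :=
  Set.range fun r : Fin n → Fin m => (A.submatrix r id).det

/-- `d` is a greatest common divisor of the set `S`. -/
def IsGreatestCommonDivisor (S : Set R) (d : R) : Prop :=
  (∀ a ∈ S, d ∣ a) ∧ ∀ c : R, (∀ a ∈ S, c ∣ a) → c ∣ d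

end OrderIdeal

/-- `Δ` is a `γ`-twisted Alexander polynomial: a greatest common divisor of the maximal minors of a
presentation matrix of the twisted homology module. -/
def IsTwistedAlexanderPolynomial {π : Type} [Group π] {N : ℕ} (γ : π →* GL (Fin N) ℤ)
    (ε : π →* Multiplicative ℤ) (Δ : ℤ[T;T⁻¹]) : Prop :=
  ∃ (m n : ℕ) (A : Matrix (Fin m) (Fin n) ℤ[T;T⁻¹]),
    IsPresentationMatrix A (TwistedH1 γ ε) ∧ IsGreatestCommonDivisor (maximalMinors A) Δ

/-- The homomorphism `π → ℤ` given by an identification of the abelianization of `π` with the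
infinite cyclic group.  For a knot group there are two such identifications, one for each
orientation of the knot. -/
def abelianizationHom {π : Type} [Group π] (e : Abelianization π ≃* Multiplicative ℤ) :
    π →* Multiplicative ℤ :=
  e.toMonoidHom.comp Abelianization.of

/-- Up to a unit `± t ^ i` of `ℤ[t, t⁻¹]`, `Δ` is a finite product of cyclotomic polynomials. -/
def IsProductOfCyclotomics (Δ : ℤ[T;T⁻¹]) : Prop :=
  ∃ s : Multiset ℕ, (∀ n ∈ s, 0 < n) ∧
    Associated Δ (Polynomial.toLaurent (s.map fun n => Polynomial.cyclotomic n ℤ).prod)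

end

open scoped LaurentPolynomial

noncomputable section

/-! After rescaling, the knot complement is the part of a sphere in `ℂ²` where `a ^ q ≠ b ^ p`. The
circle action `(a, b) ↦ (λ ^ p a, λ ^ q b)` preserves it, so the orbit of the base point is a
central loop `z` (`ContinuousMap.Homotopy.loop_mem_center`). Along this orbit `a ^ q - b ^ p` winds
`pq ≠ 0` times around `0`, so `z` survives in the abelianization
(`ContinuousMap.Homotopy.abelianizationHom_loop_ne_one`).

Permutations of `N` letters have order dividing `N!`, so `w = z ^ (± N!)` is central with `γ w = 1`
and `ε w = k > 0`, and it acts on the coefficients as the scalar `t ^ k`. Central elements act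
trivially on group homology, hence `t ^ k - 1` kills `H` (`groupHomology.smul_H1_of_mem_center`). If
`a` kills a module presented on `n` generators, then `a ^ n` is a combination of the maximal minors.
So `Δ` divides `(t ^ k - 1) ^ n`, a product of cyclotomic polynomials, each prime in `Λ`.

Existence of `Δ` needs a finite presentation of `H`. As `Λ` is Noetherian, it suffices that the knot
group is finitely generated. For this, two open sets cover the complement and meet in a
path-connected set, and the loops in each lie in one cyclic subgroup; the generation half of van
Kampen does the rest. -/

/-! ### Minors, annihilators and greatest common divisors. -/

theorem dvd_det_mul_of_forall_dvd_maximalMinors {R : Type*} [CommRing R] {m n : ℕ}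
    (A : Matrix (Fin m) (Fin n) R) (B : Matrix (Fin n) (Fin m) R) (d : R)
    (h : ∀ a ∈ maximalMinors A, d ∣ a) : d ∣ (B * A).det := by
  have key : (B * A) = fun i => ∑ j, B i j • A j := by
    ext i k
    simp [Matrix.mul_apply]
  -- A crude Cauchy–Binet formula: expand each row of `B * A` by multilinearity, keeping selections
  -- with repeated rows.
  have : (B * A).det = ∑ r : Fin n → Fin m, (∏ i, B i (r i)) * (A.submatrix r id).det := by
    rw [key]
    have := (Matrix.detRowAlternating (R := R) (n := Fin n)).toMultilinearMap.map_sum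
      (g := fun i j => B i j • A j)
    refine this.trans (Finset.sum_congr rfl fun r _ => ?_)
    exact MultilinearMap.map_smul_univ _ (fun i => B i (r i)) (fun i => A (r i))
  rw [this]
  exact Finset.dvd_sum fun r _ => Dvd.dvd.mul_left (h _ ⟨r, rfl⟩) _

/-- Each `a • eᵢ` is a relation, hence a combination of the rows of `A`. Thus `B * A = a • 1` for
some `B`, and the determinant is `a ^ n`. -/
theorem dvd_pow_of_smul_eq_zero_of_isPresentationMatrix {R : Type*} [CommRing R] {m n : ℕ}
    {A : Matrix (Fin m) (Fin n) R} {M : Type*} [AddCommGroup M] [Module R M]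
    (hA : IsPresentationMatrix A M) {a : R} (ha : ∀ x : M, a • x = 0) {d : R}
    (h : ∀ b ∈ maximalMinors A, d ∣ b) : d ∣ a ^ n := by
  obtain ⟨φ, -, hker⟩ := hA
  have hrow : ∀ i : Fin n, ∃ c : Fin m → R, ∑ j, c j • A j = Pi.single i a := by
    intro i
    have : (Pi.single i a : Fin n → R) ∈ Submodule.span R (Set.range A.row) := by
      rw [← hker, LinearMap.mem_ker]
      have : (Pi.single i a : Fin n → R) = a • Pi.single i 1 := by
        rw [← Pi.single_smul]; simp
      rw [this, map_smul, ha]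
    rw [Submodule.mem_span_range_iff_exists_fun] at this
    exact this
  choose B hB using hrow
  have hBA : Matrix.of B * A = Matrix.diagonal fun _ => a := by
    ext i k
    have := congrFun (hB i) k
    simp only [Finset.sum_apply, Pi.smul_apply, smul_eq_mul] at this
    rw [Matrix.mul_apply]
    simp only [Matrix.of_apply, this, Matrix.diagonal_apply, Pi.single_apply]
    simp [eq_comm]
  have := dvd_det_mul_of_forall_dvd_maximalMinors A (Matrix.of B) d h
  rwa [hBA, Matrix.det_diagonal, Finset.prod_const, Finset.card_univ, Fintype.card_fin] at this

theorem exists_isPresentationMatrix {R : Type*} [CommRing R] [IsNoetherianRing R] (M : Type*)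
    [AddCommGroup M] [Module R M] [Module.Finite R M] :
    ∃ (m n : ℕ) (A : Matrix (Fin m) (Fin n) R), IsPresentationMatrix A M := by
  obtain ⟨n, φ, hφ⟩ := Module.Finite.exists_fin' R M
  obtain ⟨m, A, hA⟩ := Submodule.fg_iff_exists_fin_generating_family.1
    (IsNoetherian.noetherian (LinearMap.ker φ))
  exact ⟨m, n, A, φ, hφ, hA.symm⟩

theorem exists_isGreatestCommonDivisor_of_finite {R : Type*} [CommRing R] [IsDomain R]
    [UniqueFactorizationMonoid R] {S : Set R} (hS : S.Finite) :
    ∃ d, IsGreatestCommonDivisor S d := by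
  classical
  let _ : StrongNormalizationMonoid R := UniqueFactorizationMonoid.strongNormalizationMonoid
  let _ : NormalizedGCDMonoid R := UniqueFactorizationMonoid.toNormalizedGCDMonoid R
  refine ⟨hS.toFinset.gcd id, fun a ha => Finset.gcd_dvd (f := id) (hS.mem_toFinset.2 ha),
    fun c hc => Finset.dvd_gcd fun a ha => hc a (hS.mem_toFinset.1 ha)⟩

/-! ### Cyclotomic factors in the Laurent polynomial ring. -/

instance LaurentPolynomial.isNoetherianRing {R : Type*} [CommRing R] [IsNoetherianRing R] :
    IsNoetherianRing R[T;T⁻¹] :=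
  IsLocalization.isNoetherianRing (Submonoid.powers (Polynomial.X : Polynomial R)) _ inferInstance

theorem LaurentPolynomial.uniqueFactorizationMonoid {R : Type*} [CommRing R] [IsDomain R]
    [UniqueFactorizationMonoid R] : UniqueFactorizationMonoid R[T;T⁻¹] :=
  UniqueFactorizationMonoid.of_isLocalization
    (Submonoid.powers (Polynomial.X : Polynomial R)) _

theorem exists_multiset_associated_of_dvd_prod {M : Type*} [CommMonoidWithZero M]
    [IsCancelMulZero M] {ι : Type*} (f : ι → M)
    (s : Multiset ι) (hs : ∀ i ∈ s, Prime (f i)) {d : M} (hd : d ∣ (s.map f).prod) :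
    ∃ t ≤ s, Associated d (t.map f).prod := by
  induction s using Multiset.induction_on generalizing d with
  | empty =>
    refine ⟨0, le_rfl, ?_⟩
    simpa using isUnit_of_dvd_one (by simpa using hd)
  | cons i s ih =>
    have hi : Prime (f i) := hs i (Multiset.mem_cons_self _ _)
    have hs' : ∀ j ∈ s, Prime (f j) := fun j hj => hs j (Multiset.mem_cons_of_mem hj)
    rw [Multiset.map_cons, Multiset.prod_cons] at hd
    by_cases h : f i ∣ d
    · obtain ⟨d', rfl⟩ := h
      obtain ⟨t, ht, hdt⟩ := ih hs' ((mul_dvd_mul_iff_left hi.ne_zero).1 hd)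
      exact ⟨i ::ₘ t, Multiset.cons_le_cons i ht, by
        simpa using hdt.mul_left (f i)⟩
    · obtain ⟨e, he⟩ := hd
      obtain ⟨e', rfl⟩ : f i ∣ e := (hi.dvd_or_dvd ⟨_, he.symm⟩).resolve_left h
      have : d ∣ (s.map f).prod := by
        refine ⟨e', mul_left_cancel₀ hi.ne_zero ?_⟩
        rw [he, mul_left_comm]
      obtain ⟨t, ht, hdt⟩ := ih hs' this
      exact ⟨t, ht.trans (Multiset.le_cons_self _ _), hdt⟩

/-- Laurent polynomials localize `ℤ[X]` at the powers of `X`, and a prime survives if it divides no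
such power. -/
theorem prime_toLaurent_cyclotomic {n : ℕ} (hn : 0 < n) :
    Prime (Polynomial.toLaurent (Polynomial.cyclotomic n ℤ)) := by
  have hirr := Polynomial.cyclotomic.irreducible hn
  have hp : Prime (Polynomial.cyclotomic n ℤ) := hirr.prime
  have hne : Polynomial.cyclotomic n ℤ ≠ 0 := hirr.ne_zero
  have hdisj : Disjoint ((Submonoid.powers (Polynomial.X : Polynomial ℤ)) : Set (Polynomial ℤ))
      (Ideal.span {Polynomial.cyclotomic n ℤ} : Ideal (Polynomial ℤ)) := by
    rw [Set.disjoint_left]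
    rintro _ ⟨k, rfl⟩ hk
    have hk' : Polynomial.cyclotomic n ℤ ∣ Polynomial.X ^ k := Ideal.mem_span_singleton.1 hk
    have hX : Polynomial.cyclotomic n ℤ ∣ Polynomial.X := hp.dvd_of_dvd_pow hk'
    have hass := hirr.associated_of_dvd Polynomial.irreducible_X hX
    have h0 : (Polynomial.cyclotomic n ℤ).eval 0 = 0 := by
      obtain ⟨c, hc⟩ := hass.symm.dvd
      rw [hc]; simp
    -- A zero at `0` is impossible for a divisor of `X ^ n - 1`, whose value there is `-1`.
    have : (Polynomial.cyclotomic n ℤ) ∣ Polynomial.X ^ n - 1 :=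
      Polynomial.cyclotomic.dvd_X_pow_sub_one n ℤ
    obtain ⟨c, hc⟩ := this
    have := congrArg (Polynomial.eval 0) hc
    rw [Polynomial.eval_mul, h0] at this
    simp [hn.ne'] at this
  have := IsLocalization.isPrime_of_isPrime_disjoint
    (Submonoid.powers (Polynomial.X : Polynomial ℤ)) ℤ[T;T⁻¹] _
    ((Ideal.span_singleton_prime hne).2 hp) hdisj
  rw [Ideal.map_span, Set.image_singleton, Ideal.span_singleton_prime] at this
  · simpa using this
  · simpa using hne

theorem toLaurent_X_pow_sub_one {k : ℕ} (hk : 0 < k) :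
    Polynomial.toLaurent (Polynomial.X ^ k - 1 : Polynomial ℤ) =
      ((k.divisors.val).map fun d => Polynomial.toLaurent (Polynomial.cyclotomic d ℤ)).prod := by
  rw [← Polynomial.prod_cyclotomic_eq_X_pow_sub_one hk, map_prod]
  rfl

theorem isProductOfCyclotomics_of_dvd {k n : ℕ} (hk : 0 < k) {Δ : ℤ[T;T⁻¹]}
    (h : Δ ∣ (LaurentPolynomial.T k - 1) ^ n) : IsProductOfCyclotomics Δ := by
  have hT : (LaurentPolynomial.T k - 1 : ℤ[T;T⁻¹]) =
      Polynomial.toLaurent (Polynomial.X ^ k - 1 : Polynomial ℤ) := by simp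
  rw [hT, toLaurent_X_pow_sub_one hk, ← Multiset.prod_nsmul, ← Multiset.map_nsmul] at h
  obtain ⟨t, ht, hΔ⟩ := exists_multiset_associated_of_dvd_prod _ _ (fun d hd =>
    prime_toLaurent_cyclotomic (Nat.pos_of_mem_divisors (n := k) (by
      simpa using Multiset.mem_of_mem_nsmul hd))) h
  refine ⟨t, fun d hd => Nat.pos_of_mem_divisors (n := k) (by
      simpa using Multiset.mem_of_mem_nsmul (Multiset.mem_of_le ht hd)), ?_⟩
  rwa [map_multiset_prod, Multiset.map_map]

/-! ### First group homology: finiteness and the action of the center. -/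

section GroupHomology

open groupHomology Finsupp

universe u
variable {k G : Type u} [CommRing k] [Group G] (A : Rep.{u} k G)

theorem groupHomology.single_mul_mkQ_boundaries₁ (g h : G) (a : A) :
    (boundaries₁ A).mkQ (single (g * h) a) =
      (boundaries₁ A).mkQ (single h (A.ρ g⁻¹ a)) + (boundaries₁ A).mkQ (single g a) := by
  have h' : (boundaries₁ A).mkQ (d₂₁ A (single (g, h) a)) = 0 := by
    rw [Submodule.mkQ_apply, Submodule.Quotient.mk_eq_zero]
    exact ⟨_, rfl⟩
  rw [d₂₁_single, map_add, map_sub] at h'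
  rw [← sub_eq_zero, ← neg_eq_zero, ← h']
  abel

/-- Modulo boundaries, chains on `g * h` and on `g⁻¹` reduce to chains on `g` and `h`, so the chains
supported on a finite generating set span. -/
theorem groupHomology.finite_quotient_boundaries₁ [Group.FG G] [Module.Finite k A] :
    Module.Finite k ((G →₀ A) ⧸ boundaries₁ A) := by
  classical
  obtain ⟨S, hS⟩ := (Group.fg_def.1 ‹Group.FG G› : (⊤ : Subgroup G).FG)
  let L : G → A →ₗ[k] ((G →₀ A) ⧸ boundaries₁ A) := fun g => (boundaries₁ A).mkQ ∘ₗ lsingle g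
  let W : Submodule k ((G →₀ A) ⧸ boundaries₁ A) := S.sup fun s => LinearMap.range (L s)
  have hmul : ∀ g h a, L (g * h) a = L h (A.ρ g⁻¹ a) + L g a :=
    groupHomology.single_mul_mkQ_boundaries₁ A
  have hone : ∀ a, L 1 a = 0 := fun a => by
    have := hmul 1 1 a
    simpa using this
  have hW : ∀ g : G, ∀ a, L g a ∈ W := by
    intro g
    have hg : g ∈ Subgroup.closure (S : Set G) := hS ▸ Subgroup.mem_top g
    induction hg using Subgroup.closure_induction with
    | mem s hs => exact fun a => Finset.le_sup (f := fun s => LinearMap.range (L s)) hs ⟨a, rfl⟩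
    | one => exact fun a => by rw [hone]; exact W.zero_mem
    | mul g h _ _ hg hh => exact fun a => by rw [hmul]; exact W.add_mem (hh _) (hg _)
    | inv g _ hg =>
      intro a
      have := hmul g⁻¹ g a
      rw [inv_mul_cancel, hone] at this
      rw [eq_neg_of_add_eq_zero_right this.symm]
      exact W.neg_mem (hg _)
  have htop : W = ⊤ := by
    rw [eq_top_iff]
    rintro x -
    obtain ⟨c, rfl⟩ := (boundaries₁ A).mkQ_surjective x
    induction c using Finsupp.induction_linear with
    | zero => simp
    | add c d hc hd => rw [map_add]; exact W.add_mem hc hd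
    | single g a => exact hW g a
  refine Module.finite_def.2 (htop ▸ ?_)
  exact Submodule.fg_finset_sup _ _ fun s _ => Module.Finite.fg_top.map (L s) |> fun h => by
    rwa [Submodule.map_top] at h

/-- Cycles modulo boundaries embed in the finite module of chains modulo boundaries; Noetherianity
passes finiteness to this submodule. -/
theorem groupHomology.finite_H1 [IsNoetherianRing k] [Group.FG G] [Module.Finite k A] :
    Module.Finite k (H1 A) := by
  have := groupHomology.finite_quotient_boundaries₁ A
  let f : cycles₁ A →ₗ[k] ((G →₀ A) ⧸ boundaries₁ A) :=
    (boundaries₁ A).mkQ ∘ₗ (cycles₁ A).subtype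
  have hker : LinearMap.ker f ≤ LinearMap.ker (H1π A).hom := by
    intro x hx
    rw [LinearMap.mem_ker] at hx ⊢
    refine (H1π_eq_zero_iff x).2 ?_
    simpa [f] using hx
  have hsurj : Function.Surjective (H1π A).hom := (ModuleCat.epi_iff_surjective _).1 inferInstance
  have : Module.Finite k (cycles₁ A ⧸ LinearMap.ker f) :=
    Module.Finite.equiv f.quotKerEquivRange.symm
  refine Module.Finite.of_surjective ((LinearMap.ker f).liftQ (H1π A).hom hker) fun x => ?_
  obtain ⟨c, rfl⟩ := hsurj x
  exact ⟨Submodule.Quotient.mk c, rfl⟩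

/-- The map `[g] a ↦ [z, g] a - [g, z] a` is a chain homotopy between the action of `z` and the
identity: as `z * g = g * z`, the middle terms of the two boundaries cancel, and what remains beyond
`(r - 1) [g] a` vanishes on cycles. -/
theorem groupHomology.smul_H1_of_mem_center {z : G} (hz : z ∈ Subgroup.center G) {r : k}
    (hr : ∀ a : A, A.ρ z⁻¹ a = r • a) (x : H1 A) : (r - 1) • x = 0 := by
  induction x using H1_induction_on with
  | h c =>
  rw [← map_smul, H1π_eq_zero_iff]
  have key : ∀ c : G →₀ A, ∃ y : G × G →₀ A,
      d₂₁ A y = (r - 1) • c - single z (d₁₀ A c) := by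
    intro c
    induction c using Finsupp.induction_linear with
    | zero => exact ⟨0, by simp⟩
    | add c d hc hd =>
      obtain ⟨y, hy⟩ := hc
      obtain ⟨y', hy'⟩ := hd
      refine ⟨y + y', ?_⟩
      rw [map_add, hy, hy', map_add, single_add, smul_add]
      abel
    | single g a =>
      refine ⟨single (z, g) a - single (g, z) a, ?_⟩
      rw [map_sub, d₂₁_single, d₂₁_single, d₁₀_single]
      simp only [hr, (Subgroup.mem_center_iff.1 hz g), sub_smul, one_smul, smul_single, single_sub]
      abel
  obtain ⟨y, hy⟩ := key c
  rw [(LinearMap.mem_ker.1 c.2 : d₁₀ A c.1 = 0), single_zero, sub_zero] at hy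
  exact ⟨y, hy⟩

end GroupHomology

/-! ### From a central element to the Alexander polynomial. -/

theorem IsPermutationRepresentation.pow_factorial_eq_one {π : Type} [Group π] {N : ℕ}
    {γ : π →* GL (Fin N) ℤ} (hγ : IsPermutationRepresentation γ) (g : π) :
    γ (g ^ N.factorial) = 1 := by
  obtain ⟨σ, hσ⟩ := hγ g
  have hpow : ∀ n : ℕ, ((σ ^ n).permMatrix ℤ) = (σ.permMatrix ℤ) ^ n := by
    intro n
    induction n with
    | zero => simp
    | succ n ih => rw [pow_succ, pow_succ', Matrix.permMatrix_mul, ih]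
  ext1
  rw [map_pow, Units.val_pow_eq_pow_val, hσ, ← hpow]
  have : σ ^ N.factorial = 1 := by
    have := pow_card_eq_one (x := σ)
    rwa [Fintype.card_perm, Fintype.card_fin] at this
  simp [this]

theorem TwistedH1.T_sub_one_smul_eq_zero {π : Type} [Group π] {N : ℕ}
    {γ : π →* GL (Fin N) ℤ} {ε : π →* Multiplicative ℤ} {z : π} (hz : z ∈ Subgroup.center π)
    (hγ : γ z = 1) (x : TwistedH1 γ ε) :
    (LaurentPolynomial.T (ε z).toAdd - 1 : ℤ[T;T⁻¹]) • x = 0 := by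
  refine groupHomology.smul_H1_of_mem_center _ hz (fun a => ?_) x
  -- The left action is `g • m = m · g⁻¹`, so `z⁻¹` acts by the matrix of `z` itself.
  change Matrix.vecMul a (twistedMatrix γ ε z⁻¹⁻¹) = _
  rw [inv_inv, twistedMatrix, hγ]
  simp [Matrix.vecMul_smul]

theorem isProductOfCyclotomics_of_mem_center {π : Type} [Group π] [Group.FG π] {N : ℕ}
    {γ : π →* GL (Fin N) ℤ} (hγ : IsPermutationRepresentation γ) {ε : π →* Multiplicative ℤ}
    {z : π} (hz : z ∈ Subgroup.center π) (hε : ε z ≠ 1) :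
    (∃ Δ : ℤ[T;T⁻¹], IsTwistedAlexanderPolynomial γ ε Δ) ∧
    ∀ Δ : ℤ[T;T⁻¹], IsTwistedAlexanderPolynomial γ ε Δ → IsProductOfCyclotomics Δ := by
  have : UniqueFactorizationMonoid ℤ[T;T⁻¹] := LaurentPolynomial.uniqueFactorizationMonoid
  have : Module.Finite ℤ[T;T⁻¹] (Rep.of (twistedRepresentation γ ε)) :=
    inferInstanceAs (Module.Finite ℤ[T;T⁻¹] (Fin N → ℤ[T;T⁻¹]))
  have : Module.Finite ℤ[T;T⁻¹] (TwistedH1 γ ε) := groupHomology.finite_H1 _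
  constructor
  · obtain ⟨m, n, A, hA⟩ := exists_isPresentationMatrix (R := ℤ[T;T⁻¹]) (TwistedH1 γ ε)
    obtain ⟨Δ, hΔ⟩ := exists_isGreatestCommonDivisor_of_finite (Set.finite_range
      fun r : Fin n → Fin m => (A.submatrix r id).det)
    exact ⟨Δ, m, n, A, hA, hΔ⟩
  · rintro Δ ⟨m, n, A, hA, hΔ⟩
    -- The power `N!` kills `γ`; passing to the inverse if necessary makes the exponent positive.
    obtain ⟨w, k, hw, hk, hγw, hεw⟩ : ∃ (w : π) (k : ℕ), w ∈ Subgroup.center π ∧ 0 < k ∧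
        γ w = 1 ∧ (ε w).toAdd = k := by
      have hne : (ε (z ^ N.factorial)).toAdd ≠ 0 := by
        rw [map_pow, toAdd_pow]
        exact smul_ne_zero N.factorial_ne_zero fun h => hε (by simpa using h)
      have hc := pow_mem hz N.factorial
      have hone := hγ.pow_factorial_eq_one z
      rcases lt_or_gt_of_ne hne with h | h
      · exact ⟨(z ^ N.factorial)⁻¹, (-(ε (z ^ N.factorial)).toAdd).toNat, inv_mem hc, by omega,
          by rw [map_inv, hone, inv_one], by rw [map_inv, toAdd_inv]; omega⟩
      · exact ⟨z ^ N.factorial, (ε (z ^ N.factorial)).toAdd.toNat, hc, by omega, hone, by omega⟩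
    refine isProductOfCyclotomics_of_dvd (n := n) hk ?_
    refine dvd_pow_of_smul_eq_zero_of_isPresentationMatrix hA (fun x => ?_) hΔ.1
    rw [← hεw]
    exact TwistedH1.T_sub_one_smul_eq_zero hw hγw x

/-! ### Generation of fundamental groups, and central loops. -/

section FundamentalGroup

open CategoryTheory

variable {X : Type*} [TopologicalSpace X]

/-- By the Lebesgue number lemma, a path is a finite concatenation of subpaths each inside one set
of the cover. -/
theorem Path.Homotopic.Quotient.induction_open_cover {ι : Type*} {c : ι → Set X}
    (hc : ∀ i, IsOpen (c i)) (hcov : ∀ x, ∃ i, x ∈ c i)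
    {Q : ∀ {a b : X}, Path.Homotopic.Quotient a b → Prop}
    (htrans : ∀ {a b d : X} (p : Path.Homotopic.Quotient a b) (q : Path.Homotopic.Quotient b d),
      Q p → Q q → Q (p.trans q))
    (hsub : ∀ {a b : X} (γ : Path a b) (i : ι), Set.range γ ⊆ c i → Q (mk γ))
    {a b : X} (p : Path.Homotopic.Quotient a b) : Q p := by
  obtain ⟨γ, rfl⟩ := mk_surjective p
  obtain ⟨t, ht0, htm, ⟨n, hn⟩, ht⟩ := exists_monotone_Icc_subset_open_cover_unitInterval
    (c := fun i => γ ⁻¹' c i) (fun i => (hc i).preimage γ.continuous)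
    (fun s _ => Set.mem_iUnion.2 (hcov (γ s)))
  have key : ∀ m, Q (mk (γ.subpath 0 (t m))) := by
    intro m
    induction m with
    | zero =>
      rw [ht0, Path.subpath_self]
      obtain ⟨i, hi⟩ := hcov (γ 0)
      exact hsub _ i (by simpa using hi)
    | succ m ih =>
      obtain ⟨i, hi⟩ := ht m
      have h := htrans _ _ ih (hsub (γ.subpath (t m) (t (m + 1))) i (by
        rw [Path.range_subpath_of_le _ _ _ (htm m.le_succ)]
        exact Set.image_subset_iff.2 hi))
      rwa [← mk_trans, eq.2 ⟨Path.Homotopy.subpathTransSubpath γ _ _ _⟩] at h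
  have h1 := key n
  rw [hn n le_rfl, Path.subpath_zero_one] at h1
  have hcast : ∀ {a' b' : X} (ha : a' = a) (hb : b' = b), Q (mk (γ.cast ha hb)) → Q (mk γ) := by
    rintro a' b' rfl rfl h
    simpa using h
  exact hcast _ _ h1

/-- The generation half of the Seifert-van Kampen theorem. -/
theorem FundamentalGroup.eq_top_of_open_cover {U V : Set X} (hU : IsOpen U) (hV : IsOpen V)
    (hUV : U ∪ V = Set.univ) (hUc : IsPathConnected U) (hVc : IsPathConnected V)
    (hUVc : IsPathConnected (U ∩ V)) {x₀ : X} (hx₀ : x₀ ∈ U ∩ V)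
    (G : Subgroup (FundamentalGroup X x₀))
    (hGU : ∀ γ : Path x₀ x₀, Set.range γ ⊆ U → fromPath (.mk γ) ∈ G)
    (hGV : ∀ γ : Path x₀ x₀, Set.range γ ⊆ V → fromPath (.mk γ) ∈ G) : G = ⊤ := by
  -- One connecting path per point must serve both sets; path-connectedness of `U ∩ V` supplies it
  -- over the overlap.
  have hP : ∀ y, ∃ γ : Path x₀ y, (y ∈ U → Set.range γ ⊆ U) ∧ (y ∈ V → Set.range γ ⊆ V) := by
    intro y
    by_cases hyU : y ∈ U
    · by_cases hyV : y ∈ V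
      · obtain ⟨γ, hγ⟩ := hUVc.joinedIn x₀ hx₀ y ⟨hyU, hyV⟩
        exact ⟨γ, fun _ => Set.range_subset_iff.2 fun t => (hγ t).1,
          fun _ => Set.range_subset_iff.2 fun t => (hγ t).2⟩
      · obtain ⟨γ, hγ⟩ := hUc.joinedIn x₀ hx₀.1 y hyU
        exact ⟨γ, fun _ => Set.range_subset_iff.2 hγ, fun h => absurd h hyV⟩
    · have hyV : y ∈ V := (hUV.symm ▸ Set.mem_univ y : y ∈ U ∪ V).resolve_left hyU
      obtain ⟨γ, hγ⟩ := hVc.joinedIn x₀ hx₀.2 y hyV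
      exact ⟨γ, fun h => absurd h hyU, fun _ => Set.range_subset_iff.2 hγ⟩
  choose P hPU hPV using hP
  let P' : ∀ y, FundamentalGroupoid.mk x₀ ⟶ FundamentalGroupoid.mk y := fun y => .mk (P y)
  let Q : ∀ {a b : X}, Path.Homotopic.Quotient a b → Prop := fun {a b} τ =>
    ((P' a ≫ (show FundamentalGroupoid.mk a ⟶ FundamentalGroupoid.mk b from τ) ≫
      Groupoid.inv (P' b) : FundamentalGroupoid.mk x₀ ⟶ FundamentalGroupoid.mk x₀) :
        FundamentalGroup X x₀) ∈ G
  have hsubset : ∀ {W : Set X}, (∀ y, y ∈ W → Set.range (P y) ⊆ W) →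
      (∀ γ : Path x₀ x₀, Set.range γ ⊆ W → fromPath (.mk γ) ∈ G) →
      ∀ {a b : X} (γ : Path a b), Set.range γ ⊆ W → Q (.mk γ) := by
    intro W hPW hGW a b γ hγ
    refine hGW ((P a).trans (γ.trans (P b).symm)) ?_
    rw [Path.trans_range, Path.trans_range, Path.symm_range]
    exact Set.union_subset (hPW a (hγ ⟨0, γ.source⟩))
      (Set.union_subset hγ (hPW b (hγ ⟨1, γ.target⟩)))
  have hQ : ∀ {a b : X} (p : Path.Homotopic.Quotient a b), Q p := by
    intro a b p
    refine Path.Homotopic.Quotient.induction_open_cover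
      (c := fun i : Bool => bif i then U else V)
      (Bool.rec hV hU) (fun x => ?_) (Q := Q) ?_ ?_ p
    · rcases (hUV.symm ▸ Set.mem_univ x : x ∈ U ∪ V) with h | h
      exacts [⟨true, h⟩, ⟨false, h⟩]
    · intro a b d p q hp hq
      -- The product in the fundamental group composes paths from right to left, hence the order.
      have := G.mul_mem hq hp
      refine (congrArg (· ∈ G) ?_).mp this
      let p' : FundamentalGroupoid.mk a ⟶ FundamentalGroupoid.mk b := p
      let q' : FundamentalGroupoid.mk b ⟶ FundamentalGroupoid.mk d := q
      change (P' a ≫ p' ≫ Groupoid.inv (P' b)) ≫ (P' b ≫ q' ≫ Groupoid.inv (P' d)) =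
        P' a ≫ (p' ≫ q') ≫ Groupoid.inv (P' d)
      simp
    · rintro a b γ (_ | _) hγ
      exacts [hsubset hPV hGV γ hγ, hsubset hPU hGU γ hγ]
  rw [eq_top_iff]
  rintro τ -
  -- The chosen path at `x₀` need not be constant, but as a loop in `U` it lies in `G` and can be
  -- conjugated away.
  have h0 : (P' x₀ : FundamentalGroup X x₀) ∈ G := hGU (P x₀) (hPU x₀ hx₀.1)
  have h1 : (P' x₀ ≫ (show FundamentalGroupoid.mk x₀ ⟶ FundamentalGroupoid.mk x₀ from τ) ≫
      Groupoid.inv (P' x₀) : FundamentalGroup X x₀) ∈ G := hQ τ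
  have h2 := G.mul_mem (G.mul_mem h0 h1) (G.inv_mem h0)
  refine (congrArg (· ∈ G) ?_).mp h2
  change Groupoid.inv (P' x₀) ≫ (P' x₀ ≫ τ ≫ Groupoid.inv (P' x₀)) ≫ P' x₀ = τ
  simp

theorem Path.Homotopic.of_lift {E : Type*} [TopologicalSpace E] [SimplyConnectedSpace E]
    (f : C(E, X)) {e e' : E} (Γ₁ Γ₂ : Path e e') {x x' : X} (γ₁ γ₂ : Path x x')
    (h₁ : ∀ t, γ₁ t = f (Γ₁ t)) (h₂ : ∀ t, γ₂ t = f (Γ₂ t)) : γ₁.Homotopic γ₂ := by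
  obtain rfl : x = f e := by simpa using h₁ 0
  obtain rfl : x' = f e' := by simpa using h₁ 1
  rw [show γ₁ = Γ₁.map f.continuous from Path.ext (funext h₁),
    show γ₂ = Γ₂.map f.continuous from Path.ext (funext h₂)]
  exact (SimplyConnectedSpace.paths_homotopic Γ₁ Γ₂).map f

/-- If `f : E → X` is invariant under an action of `ℤ` on the simply connected space `E`, then all
loops that lift to paths from `e` to a translate of `e` lie in one cyclic subgroup. -/
theorem FundamentalGroup.exists_mem_zpowers_of_lift {E : Type*} [TopologicalSpace E]
    [SimplyConnectedSpace E] (f : C(E, X)) (T : Multiplicative ℤ → C(E, E))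
    (hT_one : T 1 = .id E) (hT_mul : ∀ m n, T (m * n) = (T m).comp (T n))
    (hfT : ∀ n e, f (T n e) = f e) {e : E} {x₀ : X} (hx₀ : f e = x₀) :
    ∃ g : FundamentalGroup X x₀, ∀ (n : Multiplicative ℤ) (γ : Path x₀ x₀) (Γ : Path e (T n e)),
      (∀ t, γ t = f (Γ t)) → fromPath (.mk γ) ∈ Subgroup.zpowers g := by
  subst hx₀
  -- `S` relates `n` to the loops having a lift from `e` to `T n e`. It is a subgroup, and simple
  -- connectedness of `E` makes it single-valued, so the class for `n` is the `n`-th power of the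
  -- class for `1`.
  let S : Subgroup (Multiplicative ℤ × FundamentalGroup X (f e)) :=
    { carrier := {a | ∃ (γ : Path (f e) (f e)) (Γ : Path e (T a.1 e)),
        (∀ t, γ t = f (Γ t)) ∧ a.2 = fromPath (.mk γ)}
      one_mem' := ⟨.refl _, (Path.refl e).cast rfl (by simp [hT_one]), fun t => by simp, rfl⟩
      mul_mem' := by
        rintro ⟨m, _⟩ ⟨n, _⟩ ⟨γ, Γ, h, rfl⟩ ⟨γ', Γ', h', rfl⟩
        refine ⟨γ'.trans γ, (Γ'.trans (Γ.map (T n).continuous)).cast rfl ?_, fun t => ?_, rfl⟩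
        · simp [mul_comm m n, hT_mul]
        · simp only [Path.cast_coe, Path.trans_apply]
          split_ifs
          · exact h' _
          · simp [hfT, h]
      inv_mem' := by
        rintro ⟨m, _⟩ ⟨γ, Γ, h, rfl⟩
        refine ⟨γ.symm, (Γ.symm.map (T m⁻¹).continuous).cast ?_ rfl, fun t => ?_, rfl⟩
        · rw [← ContinuousMap.comp_apply, ← hT_mul, inv_mul_cancel, hT_one]; rfl
        · simp [hfT, h] }
  have hS : ∀ a b, a ∈ S → b ∈ S → a.1 = b.1 → a.2 = b.2 := by
    rintro ⟨m, _⟩ ⟨_, _⟩ ⟨γ, Γ, h, rfl⟩ ⟨γ', Γ', h', rfl⟩ rfl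
    exact Path.Homotopic.Quotient.eq.2 (Path.Homotopic.of_lift f Γ Γ' γ γ' h h')
  let Γ₁ : Path e (T (.ofAdd 1) e) := PathConnectedSpace.somePath _ _
  let γ₁ : Path (f e) (f e) := (Γ₁.map f.continuous).cast rfl (hfT _ _).symm
  refine ⟨fromPath (.mk γ₁), fun n γ Γ h => ⟨n.toAdd, ?_⟩⟩
  have h₁ : (Multiplicative.ofAdd 1, fromPath (.mk γ₁)) ∈ S := ⟨γ₁, Γ₁, fun t => rfl, rfl⟩
  refine hS _ (n, fromPath (.mk γ)) (S.zpow_mem h₁ n.toAdd) ⟨γ, Γ, h, rfl⟩ ?_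
  simp [← ofAdd_zsmul]

/-- The loop traced out by a point under a homotopy from the identity to itself. -/
def ContinuousMap.Homotopy.loop (H : (ContinuousMap.id X).Homotopy (ContinuousMap.id X)) (x₀ : X) :
    Path x₀ x₀ where
  toFun t := H (t, x₀)
  source' := H.apply_zero x₀
  target' := H.apply_one x₀

/-- For a loop `γ`, the square `(s, t) ↦ H (s, γ t)` has `γ` on one pair of opposite sides and the
trace of the base point on the other. -/
theorem ContinuousMap.Homotopy.loop_mem_center
    (H : (ContinuousMap.id X).Homotopy (ContinuousMap.id X)) (x₀ : X) :
    FundamentalGroup.fromPath (.mk (H.loop x₀)) ∈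
      Subgroup.center (FundamentalGroup X x₀) := by
  rw [Subgroup.mem_center_iff]
  intro g
  obtain ⟨γ, rfl⟩ := Path.Homotopic.Quotient.mk_surjective g
  exact Path.Homotopic.Quotient.eq.2 (Path.Homotopic.map_trans_evalAt H γ).symm

/-- The winding number of `F` has abelian target, so it factors through the abelianization. The lift
of the loop to `ℝ` moves by `2πn`, so its winding number is not zero. -/
theorem ContinuousMap.Homotopy.abelianizationHom_loop_ne_one {X : Type} [TopologicalSpace X]
    (H : (ContinuousMap.id X).Homotopy (ContinuousMap.id X)) (F : C(X, Circle)) {n : ℤ}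
    (hn : n ≠ 0) (hF : ∀ t x, F (H (t, x)) = Circle.exp (n * (2 * Real.pi) * t) * F x) (x₀ : X)
    (e : Abelianization (FundamentalGroup X x₀) ≃* Multiplicative ℤ) :
    abelianizationHom e (FundamentalGroup.fromPath (.mk (H.loop x₀))) ≠ 1 := by
  intro h
  have hz : Abelianization.of (FundamentalGroup.fromPath (.mk (H.loop x₀))) = 1 :=
    e.injective (h.trans (map_one e).symm)
  obtain ⟨θ, hθ⟩ : ∃ θ, Circle.exp θ = F x₀ := ⟨_, Circle.exp_arg _⟩
  let e₀ : Circle.exp ⁻¹' {F x₀} := ⟨θ, hθ⟩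
  have hper : Circle.exp (θ + n * (2 * Real.pi)) = F x₀ := by
    rw [← hθ]
    exact (Circle.periodic_exp.int_mul n) θ
  let e₁ : Circle.exp ⁻¹' {F x₀} := ⟨θ + n * (2 * Real.pi), hper⟩
  let ψ := (Circle.isAddQuotientCoveringMap_exp.fundamentalGroupToMulOpposite e₀).comp
    (FundamentalGroup.map F x₀)
  have hψ : ψ (FundamentalGroup.fromPath (.mk (H.loop x₀))) = 1 := by
    have := congrArg (Abelianization.lift ψ) hz
    rwa [Abelianization.lift_apply_of, map_one] at this
  have hψ' := (Circle.isAddQuotientCoveringMap_exp.fundamentalGroupToMulOpposite_eq_one_iff).1 hψ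
  let Γ : Path (e₀ : ℝ) (e₁ : ℝ) :=
    { toFun := fun t => θ + n * (2 * Real.pi) * t
      continuous_toFun := by fun_prop
      source' := by simp [e₀]
      target' := by simp [e₁] }
  have hmon := Circle.isCoveringMap_exp.monodromy_eq_of_map_eq
    (γ := .mk ((H.loop x₀).map F.continuous)) (ex := e₀) (ey := e₁) (.mk Γ) (by
      refine congrArg Path.Homotopic.Quotient.mk (a₁ := Γ.map Circle.exp.continuous)
        (a₂ := ((H.loop x₀).map F.continuous).cast hθ hper) ?_
      refine Path.ext (funext fun t => ?_)
      change Circle.exp (θ + n * (2 * Real.pi) * t) = F (H (t, x₀))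
      rw [hF, Circle.exp_add, hθ, mul_comm])
  have := congrArg Subtype.val (hmon.symm.trans hψ')
  simp [e₀, e₁, hn, Real.pi_ne_zero] at this

end FundamentalGroup

/-! ### One slit domain of the complement and its universal cover. -/

section TorusKnotComplement

open Complex

/-- The complement of the torus knot `a ^ q = b ^ p` in the sphere of radius `√2` in `ℂ²`. -/
abbrev TorusKnotComplement (p q : ℕ) : Type :=
  {v : ℂ × ℂ // ‖v.1‖ ^ 2 + ‖v.2‖ ^ 2 = 2 ∧ v.1 ^ q ≠ v.2 ^ p}

/-- The points `(a, b)` of the complement of a torus knot with `a ≠ 0` and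
`b ^ p / a ^ q ∉ [1, ∞)`. -/
def slitDomain (p q : ℕ) : Set (TorusKnotComplement p q) :=
  {v | v.1.1 ≠ 0 ∧ 1 - v.1.2 ^ p / v.1.1 ^ q ∈ slitPlane}

theorem isOpen_slitDomain (p q : ℕ) : IsOpen (slitDomain p q) := by
  have h : IsOpen {v : TorusKnotComplement p q | v.1.1 ≠ 0} :=
    isOpen_ne_fun (by fun_prop) continuous_const
  refine ContinuousOn.isOpen_inter_preimage (s := {v : TorusKnotComplement p q | v.1.1 ≠ 0})
    (f := fun v => 1 - v.1.2 ^ p / v.1.1 ^ q) ?_ h isOpen_slitPlane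
  exact continuousOn_const.sub (ContinuousOn.div (by fun_prop) (by fun_prop)
    fun v hv => pow_ne_zero _ hv)

/-- Coordinates `(α, c)` on the universal cover of `slitDomain p q`: the argument `α` of `a`, and
`b` after untwisting. -/
def slitCover (p q : ℕ) : Set (ℝ × ℂ) :=
  {x | ‖x.2‖ ^ 2 < 2 ∧ 1 - x.2 ^ p / (√(2 - ‖x.2‖ ^ 2) : ℂ) ^ q ∈ slitPlane}

theorem zero_mem_slitCover {p : ℕ} (hp : p ≠ 0) (q : ℕ) : (0 : ℝ × ℂ) ∈ slitCover p q := by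
  simp [slitCover, hp]

/-- Shrinking `c` enlarges `√(2 - ‖c‖ ^ 2)`, so `c ^ p / √(2 - ‖c‖ ^ 2) ^ q` is scaled by a real
factor in `[0, 1]`, and the slit plane is star-shaped about `1`. -/
theorem starConvex_slitCover (p q : ℕ) :
    StarConvex ℝ (0 : ℝ × ℂ) (slitCover p q) := by
  rw [starConvex_zero_iff]
  rintro ⟨α, c⟩ ⟨hc, hs⟩ s hs0 hs1
  have hn : ‖s • c‖ ^ 2 ≤ ‖c‖ ^ 2 := by
    rw [norm_smul, Real.norm_of_nonneg hs0]
    gcongr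
    exact mul_le_of_le_one_left (norm_nonneg _) hs1
  dsimp only at hc hs
  have hr : 0 < √(2 - ‖c‖ ^ 2) := Real.sqrt_pos.2 (by linarith)
  have hr' : √(2 - ‖c‖ ^ 2) ≤ √(2 - ‖s • c‖ ^ 2) := Real.sqrt_le_sqrt (by linarith)
  have hr'' : 0 < √(2 - ‖s • c‖ ^ 2) := hr.trans_le hr'
  refine ⟨hn.trans_lt hc, ?_⟩
  change 1 - (s • c) ^ p / (√(2 - ‖s • c‖ ^ 2) : ℂ) ^ q ∈ slitPlane
  set r := √(2 - ‖c‖ ^ 2)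
  set r' := √(2 - ‖s • c‖ ^ 2)
  have hκ : s ^ p * (r / r') ^ q ≤ 1 :=
    mul_le_one₀ (pow_le_one₀ hs0 hs1) (by positivity)
      (pow_le_one₀ (by positivity) ((div_le_one hr'').2 hr'))
  have hκ0 : 0 ≤ s ^ p * (r / r') ^ q := by positivity
  have := starConvex_one_slitPlane hs (a := 1 - s ^ p * (r / r') ^ q) (b := s ^ p * (r / r') ^ q)
    (by linarith) hκ0 (by ring)
  convert this using 1
  have h1 : (r : ℂ) ≠ 0 := by exact_mod_cast hr.ne'
  have h2 : (r' : ℂ) ≠ 0 := by exact_mod_cast hr''.ne'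
  simp only [real_smul]
  push_cast
  rw [div_pow, mul_pow]
  field_simp
  ring

theorem simplyConnectedSpace_slitCover {p : ℕ} (hp : p ≠ 0) (q : ℕ) :
    SimplyConnectedSpace (slitCover p q) :=
  have := (starConvex_slitCover p q).contractibleSpace ⟨0, zero_mem_slitCover hp q⟩
  inferInstance

theorem exp_div_natCast_pow {p : ℕ} (hp : p ≠ 0) (z : ℂ) : exp (z / p) ^ p = exp z := by
  rw [← exp_nat_mul, mul_div_cancel₀ _ (by exact_mod_cast hp)]

/-- The point of the sphere with coordinates `(α, c)`. -/
def slitCoverPoint (p q : ℕ) (x : ℝ × ℂ) : ℂ × ℂ :=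
  (√(2 - ‖x.2‖ ^ 2) * exp (x.1 * I), exp ((q * x.1 : ℝ) * I / p) * x.2)

theorem norm_exp_real_mul_I_div (α : ℝ) (p : ℕ) : ‖exp (α * I / p)‖ = 1 := by
  have : (α * I / p : ℂ) = ((α / p : ℝ) : ℂ) * I := by push_cast; ring
  rw [this, norm_exp_ofReal_mul_I]

theorem slitCoverPoint_div {p : ℕ} (hp : p ≠ 0) (q : ℕ) (x : ℝ × ℂ) :
    (slitCoverPoint p q x).2 ^ p / (slitCoverPoint p q x).1 ^ q =
      x.2 ^ p / (√(2 - ‖x.2‖ ^ 2) : ℂ) ^ q := by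
  have h : exp ((q * x.1 : ℝ) * I) = exp (x.1 * I) ^ q := by
    rw [← exp_nat_mul]; push_cast; ring_nf
  rw [slitCoverPoint, mul_pow, mul_pow, exp_div_natCast_pow hp, h, mul_comm (exp _ ^ q),
    mul_div_mul_right _ _ (pow_ne_zero _ (exp_ne_zero _))]

theorem slitCoverPoint_mem {p : ℕ} (hp : p ≠ 0) (q : ℕ) {x : ℝ × ℂ} (hx : x ∈ slitCover p q) :
    ∃ h : ‖(slitCoverPoint p q x).1‖ ^ 2 + ‖(slitCoverPoint p q x).2‖ ^ 2 = 2 ∧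
      (slitCoverPoint p q x).1 ^ q ≠ (slitCoverPoint p q x).2 ^ p,
      (⟨slitCoverPoint p q x, h⟩ : TorusKnotComplement p q) ∈ slitDomain p q := by
  have hr : 0 < √(2 - ‖x.2‖ ^ 2) := Real.sqrt_pos.2 (by linarith [hx.1])
  have h0 : (slitCoverPoint p q x).1 ≠ 0 :=
    mul_ne_zero (by exact_mod_cast hr.ne') (exp_ne_zero _)
  have hs := hx.2
  rw [← slitCoverPoint_div hp] at hs
  refine ⟨⟨?_, fun h => ?_⟩, h0, hs⟩
  · rw [slitCoverPoint, norm_mul, norm_mul, norm_exp_ofReal_mul_I, norm_exp_real_mul_I_div,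
      norm_real, Real.norm_of_nonneg hr.le, mul_one, one_mul, Real.sq_sqrt (by linarith [hx.1])]
    ring
  · rw [← h, div_self (pow_ne_zero _ h0)] at hs
    exact slitPlane_ne_zero hs (sub_self _)

/-- The covering map onto `slitDomain p q`. -/
def slitCoverMap {p : ℕ} (hp : p ≠ 0) (q : ℕ) : C(slitCover p q, TorusKnotComplement p q) where
  toFun x := ⟨slitCoverPoint p q x, (slitCoverPoint_mem hp q x.2).1⟩
  continuous_toFun := by
    unfold slitCoverPoint
    fun_prop

/-- The deck transformations of `slitCoverMap`. -/
def slitCoverDeck {p : ℕ} (hp : p ≠ 0) (q : ℕ) (n : Multiplicative ℤ) :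
    C(slitCover p q, slitCover p q) where
  toFun x := ⟨(x.1.1 + n.toAdd * (2 * Real.pi),
    exp ((-(q * (n.toAdd * (2 * Real.pi))) : ℝ) * I / p) * x.1.2), by
      have h : exp ((-(q * (n.toAdd * (2 * Real.pi))) : ℝ) * I) = 1 :=
        exp_eq_one_iff.2 ⟨-(q * n.toAdd), by push_cast; ring⟩
      have := x.2
      simpa only [slitCover, Set.mem_ofPred_eq, norm_mul, norm_exp_real_mul_I_div, one_mul, mul_pow,
        exp_div_natCast_pow hp, h] using this⟩
  continuous_toFun := by fun_prop

theorem slitCoverMap_deck {p : ℕ} (hp : p ≠ 0) (q : ℕ) (n : Multiplicative ℤ)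
    (x : slitCover p q) : slitCoverMap hp q (slitCoverDeck hp q n x) = slitCoverMap hp q x := by
  refine Subtype.ext (Prod.ext ?_ ?_)
  · simp only [slitCoverMap, slitCoverDeck, slitCoverPoint, ContinuousMap.coe_mk, norm_mul,
      norm_exp_real_mul_I_div, one_mul]
    congr 1
    exact exp_eq_exp_iff_exists_int.2 ⟨n.toAdd, by push_cast; ring⟩
  · simp only [slitCoverMap, slitCoverDeck, slitCoverPoint, ContinuousMap.coe_mk]
    rw [← mul_assoc, ← exp_add]
    congr 2
    push_cast
    ring

theorem slitCoverDeck_one {p : ℕ} (hp : p ≠ 0) (q : ℕ) :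
    slitCoverDeck hp q 1 = .id _ := by
  ext x <;> simp [slitCoverDeck]

theorem slitCoverDeck_mul {p : ℕ} (hp : p ≠ 0) (q : ℕ) (m n : Multiplicative ℤ) :
    slitCoverDeck hp q (m * n) = (slitCoverDeck hp q m).comp (slitCoverDeck hp q n) := by
  ext x
  · simp only [slitCoverDeck, ContinuousMap.coe_mk, ContinuousMap.comp_apply, toAdd_mul]
    push_cast
    ring
  · simp only [slitCoverDeck, ContinuousMap.coe_mk, ContinuousMap.comp_apply, toAdd_mul]
    rw [← mul_assoc (exp _) (exp _), ← exp_add]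
    congr 2
    push_cast
    ring

/-- A choice of argument for `a` alone determines the preimage, by an explicit formula; path lifting
thus reduces to lifting an angle. -/
theorem exists_slitCoverMap_eq {p : ℕ} (hp : p ≠ 0) {q : ℕ} {v : TorusKnotComplement p q}
    (hv : v ∈ slitDomain p q) {α : ℝ} (hα : v.1.1 = ‖v.1.1‖ * exp (α * I)) :
    ∃ h : (α, exp (-((q * α : ℝ) * I / p)) * v.1.2) ∈ slitCover p q,
      slitCoverMap hp q ⟨_, h⟩ = v := by
  set c := exp (-((q * α : ℝ) * I / p)) * v.1.2 with hc
  have hnc : ‖c‖ = ‖v.1.2‖ := by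
    have : (-((q * α : ℝ) * I / p) : ℂ) = (-(q * α) : ℝ) * I / p := by push_cast; ring
    rw [hc, this, norm_mul, norm_exp_real_mul_I_div, one_mul]
  have hr : √(2 - ‖c‖ ^ 2) = ‖v.1.1‖ := by
    rw [hnc, ← eq_sub_of_add_eq v.2.1, Real.sqrt_sq (norm_nonneg _)]
  have hpt : slitCoverPoint p q (α, c) = v.1 := by
    refine Prod.ext ?_ ?_
    · rw [slitCoverPoint, hr]
      exact hα.symm
    · change exp ((q * α : ℝ) * I / p) * c = v.1.2
      rw [hc, ← mul_assoc, ← exp_add, add_neg_cancel, exp_zero, one_mul]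
  refine ⟨⟨?_, ?_⟩, Subtype.ext hpt⟩
  · change ‖c‖ ^ 2 < 2
    have := norm_pos_iff.2 hv.1
    have : 0 < ‖v.1.1‖ ^ 2 := by positivity
    rw [hnc]
    linarith [v.2.1]
  · have := hv.2
    rwa [← hpt, slitCoverPoint_div hp] at this

theorem range_slitCoverMap {p : ℕ} (hp : p ≠ 0) (q : ℕ) :
    Set.range (slitCoverMap hp q) = slitDomain p q := by
  refine Set.Subset.antisymm ?_ fun v hv => ?_
  · rintro _ ⟨x, rfl⟩
    exact (slitCoverPoint_mem hp q x.2).2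
  · obtain ⟨h, h'⟩ := exists_slitCoverMap_eq hp hv (α := arg v.1.1) (norm_mul_exp_arg_mul_I _).symm
    exact ⟨_, h'⟩

theorem isPathConnected_slitDomain {p : ℕ} (hp : p ≠ 0) (q : ℕ) :
    IsPathConnected (slitDomain p q) := by
  have := simplyConnectedSpace_slitCover hp q
  rw [← range_slitCoverMap hp]
  exact isPathConnected_range (slitCoverMap hp q).continuous

/-- Lift `a / ‖a‖` through `Circle.exp`; the coordinate `c` follows. Around a loop the angle changes
by some `2πn`, so the endpoint is a deck translate. -/
theorem exists_path_slitCover_lift {p : ℕ} (hp : p ≠ 0) {q : ℕ} {e : slitCover p q}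
    {v₀ : TorusKnotComplement p q} (he : slitCoverMap hp q e = v₀) (γ : Path v₀ v₀)
    (hγ : Set.range γ ⊆ slitDomain p q) :
    ∃ (n : Multiplicative ℤ) (Γ : Path e (slitCoverDeck hp q n e)),
      ∀ t, slitCoverMap hp q (Γ t) = γ t := by
  subst he
  have hγ' : ∀ t, γ t ∈ slitDomain p q := fun t => hγ ⟨t, rfl⟩
  have hne : ∀ t, ((‖(γ t).1.1‖ : ℝ) : ℂ) ≠ 0 := fun t => by
    simpa using (hγ' t).1
  let w : C(unitInterval, Circle) :=
    { toFun := fun t => ⟨(γ t).1.1 / (‖(γ t).1.1‖ : ℝ), by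
        have := hne t
        change _ ∈ Metric.sphere (0 : ℂ) 1
        rw [mem_sphere_zero_iff_norm, norm_div, norm_real, norm_norm, div_self]
        exact_mod_cast this⟩
      continuous_toFun := by
        refine Continuous.subtype_mk (Continuous.div ?_ ?_ hne) _ <;> fun_prop }
  have hw0 : w 0 = Circle.exp e.1.1 := by
    ext
    have h1 : ((γ 0).1.1 : ℂ) = √(2 - ‖e.1.2‖ ^ 2) * exp (e.1.1 * I) := by
      rw [γ.source]; rfl
    have h2 : ‖(γ 0).1.1‖ = √(2 - ‖e.1.2‖ ^ 2) := by
      rw [h1, norm_mul, norm_exp_ofReal_mul_I, norm_real, mul_one,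
        Real.norm_of_nonneg (Real.sqrt_nonneg _)]
    have h3 := hne 0
    change (γ 0).1.1 / ((‖(γ 0).1.1‖ : ℝ) : ℂ) = exp (e.1.1 * I)
    rw [div_eq_iff h3, h2, h1, mul_comm]
  let α := Circle.isCoveringMap_exp.liftPath w e.1.1 hw0
  have hα0 : α 0 = e.1.1 := Circle.isCoveringMap_exp.liftPath_zero ..
  have hα : ∀ t, (γ t).1.1 = ‖(γ t).1.1‖ * exp (α t * I) := fun t => by
    have h : Circle.exp (α t) = w t :=
      congrFun (Circle.isCoveringMap_exp.liftPath_lifts w e.1.1 hw0) t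
    have h' : exp (α t * I) = (γ t).1.1 / ((‖(γ t).1.1‖ : ℝ) : ℂ) := congrArg Subtype.val h
    rw [h', mul_div_cancel₀ _ (hne t)]
  have hα1 : exp (α 1 * I) = exp (e.1.1 * I) := by
    have h0 := hα 0
    have h1 := hα 1
    rw [γ.target, ← γ.source] at h1
    rw [← hα0]
    exact mul_left_cancel₀ (hne 0) (h1.symm.trans h0)
  obtain ⟨n, hn⟩ := exp_eq_exp_iff_exists_int.1 hα1
  have hn' : α 1 = e.1.1 + n * (2 * Real.pi) := by
    have : ((α 1 : ℝ) : ℂ) = (e.1.1 + n * (2 * Real.pi) : ℝ) := by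
      refine mul_right_cancel₀ I_ne_zero ?_
      rw [hn]; push_cast; ring
    exact_mod_cast this
  choose hmem hmap using fun t => exists_slitCoverMap_eq hp (hγ' t) (hα t)
  have hb : (slitCoverMap hp q e).1.2 = exp ((q * e.1.1 : ℝ) * I / p) * e.1.2 := rfl
  refine ⟨.ofAdd n, ⟨⟨fun t => ⟨_, hmem t⟩, ?_⟩, ?_, ?_⟩, hmap⟩
  · fun_prop
  · refine Subtype.ext (Prod.ext hα0 ?_)
    change exp (-((q * α 0 : ℝ) * I / p)) * (γ 0).1.2 = e.1.2
    rw [γ.source, hb, hα0, ← mul_assoc, ← exp_add, neg_add_cancel, exp_zero, one_mul]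
  · refine Subtype.ext (Prod.ext hn' ?_)
    change exp (-((q * α 1 : ℝ) * I / p)) * (γ 1).1.2 =
      exp ((-(q * (n * (2 * Real.pi))) : ℝ) * I / p) * e.1.2
    rw [γ.target, hb, hn', ← mul_assoc, ← exp_add]
    congr 2
    push_cast
    ring

end TorusKnotComplement

/-! ### The two slit domains together, and finite generation of the group. -/

section TorusKnotComplement

open Complex

/-- Exchanging the two coordinates of `ℂ²`. -/
def TorusKnotComplement.swap (p q : ℕ) : TorusKnotComplement p q ≃ₜ TorusKnotComplement q p where
  toFun v := ⟨v.1.swap, by rw [add_comm]; exact v.2.1, v.2.2.symm⟩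
  invFun v := ⟨v.1.swap, by rw [add_comm]; exact v.2.1, v.2.2.symm⟩
  left_inv _ := rfl
  right_inv _ := rfl
  continuous_toFun := by fun_prop
  continuous_invFun := by fun_prop

/-- Both `[1, ∞)` and its image `(0, 1]` under inversion are removed, that is, the whole positive
axis. -/
theorem Complex.one_sub_mem_slitPlane_and_iff {u : ℂ} (hu : u ≠ 0) :
    (1 - u ∈ slitPlane ∧ 1 - u⁻¹ ∈ slitPlane) ↔ -u ∈ slitPlane := by
  have hn : 0 < normSq u := normSq_pos.2 hu
  simp only [mem_slitPlane_iff, sub_re, sub_im, one_re, one_im, neg_re, neg_im, inv_re, inv_im,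
    zero_sub, neg_ne_zero]
  by_cases him : u.im = 0
  · have hre : u.re ≠ 0 := fun h => hu (Complex.ext h him)
    have hn' : normSq u = u.re * u.re := by simp [normSq_apply, him]
    simp only [him, neg_zero, zero_div, ne_eq, not_true_eq_false, or_false, hn']
    rw [div_self_mul_self']
    constructor
    · rintro ⟨h1, h2⟩
      by_contra! h
      have hpos : 0 < u.re := lt_of_le_of_ne (by linarith) hre.symm
      have : 1 < (u.re)⁻¹ := (one_lt_inv₀ hpos).2 (by linarith)
      linarith
    · intro h
      have : (u.re)⁻¹ < 0 := inv_lt_zero.2 (by linarith)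
      constructor <;> linarith
  · have : -u.im / normSq u ≠ 0 := div_ne_zero (neg_ne_zero.2 him) hn.ne'
    simp [him, this]

/-- A point with `a, b ≠ 0` in neither domain has both `u = b ^ p / a ^ q` and `u⁻¹` in `[1, ∞)`.
Then `u = 1`, which is the equation of the knot. -/
theorem slitDomain_union (p q : ℕ) (hp : p ≠ 0) (hq : q ≠ 0) :
    slitDomain p q ∪ TorusKnotComplement.swap p q ⁻¹' slitDomain q p = Set.univ := by
  rw [Set.eq_univ_iff_forall]
  intro v
  by_contra h
  rw [Set.mem_union, not_or] at h
  obtain ⟨h1, h2⟩ := h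
  have ha : v.1.1 ≠ 0 := fun ha => h2 ⟨fun hb => by
      have := v.2.1
      change v.1.2 = 0 at hb
      simp [ha, hb] at this, by
    change 1 - v.1.1 ^ q / v.1.2 ^ p ∈ slitPlane
    simp [ha, hq]⟩
  have hb : v.1.2 ≠ 0 := fun hb => h1 ⟨ha, by simp [hb, hp]⟩
  have h1' : 1 - v.1.2 ^ p / v.1.1 ^ q ∉ slitPlane := fun h => h1 ⟨ha, h⟩
  have h2' : 1 - (v.1.2 ^ p / v.1.1 ^ q)⁻¹ ∉ slitPlane := fun h => h2 ⟨hb, by rwa [inv_div] at h⟩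
  have hu1 : v.1.2 ^ p / v.1.1 ^ q ≠ 1 := fun h =>
    v.2.2 (eq_of_div_eq_one h).symm
  have hu0 : v.1.2 ^ p / v.1.1 ^ q ≠ 0 := div_ne_zero (pow_ne_zero _ hb) (pow_ne_zero _ ha)
  generalize v.1.2 ^ p / v.1.1 ^ q = u at *
  simp only [mem_slitPlane_iff, sub_re, sub_im, one_re, one_im, inv_re, inv_im,
    zero_sub, neg_ne_zero, not_or, not_not] at h1' h2'
  obtain ⟨h1r, him⟩ := h1'
  have hre : 1 < u.re := lt_of_le_of_ne (by linarith) fun h => hu1 (Complex.ext h.symm him)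
  have hn' : normSq u = u.re * u.re := by simp [normSq_apply, him]
  rw [hn', div_self_mul_self'] at h2'
  have : (u.re)⁻¹ < 1 := inv_lt_one_of_one_lt₀ hre
  linarith [h2'.1]

theorem mem_slitDomain_inter_iff {p q : ℕ} (v : TorusKnotComplement p q) :
    v ∈ slitDomain p q ∩ TorusKnotComplement.swap p q ⁻¹' slitDomain q p ↔
      v.1.1 ≠ 0 ∧ v.1.2 ≠ 0 ∧ -(v.1.2 ^ p / v.1.1 ^ q) ∈ slitPlane := by
  constructor
  · rintro ⟨⟨ha, h1⟩, ⟨hb, h2⟩⟩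
    have hu0 : v.1.2 ^ p / v.1.1 ^ q ≠ 0 := div_ne_zero (pow_ne_zero _ hb) (pow_ne_zero _ ha)
    exact ⟨ha, hb, (one_sub_mem_slitPlane_and_iff hu0).1 ⟨h1, by rw [inv_div]; exact h2⟩⟩
  · rintro ⟨ha, hb, h⟩
    have hu0 : v.1.2 ^ p / v.1.1 ^ q ≠ 0 := div_ne_zero (pow_ne_zero _ hb) (pow_ne_zero _ ha)
    obtain ⟨h1, h2⟩ := (one_sub_mem_slitPlane_and_iff hu0).2 h
    exact ⟨⟨ha, h1⟩, ⟨hb, by rw [inv_div] at h2; exact h2⟩⟩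

/-- A parametrization of the region over which the two slit domains meet. -/
def toricPoint (p q : ℕ) (x : ℝ × ℝ × ℝ) : ℂ × ℂ :=
  (√(2 - x.2.2) * exp ((p * x.1 : ℝ) * I), √x.2.2 * exp ((q * x.1 + x.2.1 / p : ℝ) * I))

theorem toricPoint_div {p : ℕ} (hp : p ≠ 0) (q : ℕ) (x : ℝ × ℝ × ℝ) :
    (toricPoint p q x).2 ^ p / (toricPoint p q x).1 ^ q =
      (√x.2.2 ^ p / √(2 - x.2.2) ^ q : ℝ) * exp (x.2.1 * I) := by
  have hp' : (p : ℂ) ≠ 0 := by exact_mod_cast hp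
  have h : exp ((q * x.1 + x.2.1 / p : ℝ) * I) ^ p =
      exp (x.2.1 * I) * exp ((p * x.1 : ℝ) * I) ^ q := by
    rw [← exp_nat_mul, ← exp_nat_mul, ← exp_add]
    congr 1
    push_cast
    field_simp
    ring
  rw [toricPoint, mul_pow, mul_pow, h, ← mul_assoc,
    mul_div_mul_right _ _ (pow_ne_zero _ (exp_ne_zero _))]
  push_cast
  ring

theorem neg_real_mul_exp_mem_slitPlane {r φ : ℝ} (hr : 0 < r) (hφ : φ ∈ Set.Ioo 0 (2 * Real.pi)) :
    -((r : ℂ) * exp (φ * I)) ∈ slitPlane := by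
  have h : -((r : ℂ) * exp (φ * I)) = r * (cos (φ - Real.pi : ℝ) + sin (φ - Real.pi : ℝ) * I) := by
    rw [← exp_mul_I, ofReal_sub, sub_mul, exp_sub, exp_pi_mul_I]
    ring
  rw [h, mem_slitPlane_iff_arg, arg_mul_cos_add_sin_mul_I hr ⟨by linarith [hφ.1], by
    linarith [hφ.2]⟩]
  refine ⟨fun h' => by linarith [hφ.2], mul_ne_zero (by exact_mod_cast hr.ne') ?_⟩
  rw [← exp_mul_I]
  exact exp_ne_zero _

/-- The parameters are an angle along the circle orbit, the argument of `b ^ p / a ^ q` in `(0,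
2π)`, and `‖b‖ ^ 2`; their range is convex. -/
theorem image_slitDomain_inter {p q : ℕ} (hp : p ≠ 0) (hpq : p.Coprime q) :
    Subtype.val '' (slitDomain p q ∩ TorusKnotComplement.swap p q ⁻¹' slitDomain q p) =
      toricPoint p q '' (Set.univ ×ˢ Set.Ioo 0 (2 * Real.pi) ×ˢ Set.Ioo 0 2) := by
  ext v
  constructor
  · rintro ⟨⟨⟨a, b⟩, hab, hne⟩, hv, rfl⟩
    obtain ⟨ha, hb, hs⟩ := (mem_slitDomain_inter_iff _).1 hv
    dsimp only at ha hb hs hab ⊢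
    set u := b ^ p / a ^ q with hu
    have hna := norm_pos_iff.2 ha
    have hnb := norm_pos_iff.2 hb
    have hu0 : u ≠ 0 := div_ne_zero (pow_ne_zero _ hb) (pow_ne_zero _ ha)
    obtain ⟨φ, hφ, huφ⟩ : ∃ φ ∈ Set.Ioo 0 (2 * Real.pi), u = ‖u‖ * exp (φ * I) := by
      refine ⟨arg (-u) + Real.pi, ⟨by linarith [neg_pi_lt_arg (-u)], ?_⟩, ?_⟩
      · have := lt_of_le_of_ne (arg_le_pi (-u)) (mem_slitPlane_iff_arg.1 hs).1
        linarith
      · have := norm_mul_exp_arg_mul_I (-u)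
        rw [norm_neg] at this
        rw [ofReal_add, add_mul, exp_add, exp_pi_mul_I, ← mul_assoc, this]
        ring
    have hua : exp ((p * arg b - q * arg a : ℝ) * I) = exp (φ * I) := by
      refine mul_left_cancel₀ (a := (‖u‖ : ℂ)) (by simpa using hu0) ?_
      rw [← huφ, hu, norm_div, norm_pow, norm_pow]
      conv_rhs => rw [← norm_mul_exp_arg_mul_I a, ← norm_mul_exp_arg_mul_I b]
      rw [mul_pow, mul_pow, ← exp_nat_mul, ← exp_nat_mul, ofReal_sub, sub_mul, exp_sub]
      push_cast
      rw [mul_div_mul_comm, mul_assoc, mul_assoc]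
    obtain ⟨k, hk⟩ := exp_eq_exp_iff_exists_int.1 hua
    have hk' : p * arg b - q * arg a = φ + k * (2 * Real.pi) := by
      have : ((p * arg b - q * arg a : ℝ) : ℂ) = (φ + k * (2 * Real.pi) : ℝ) := by
        refine mul_right_cancel₀ I_ne_zero ?_
        rw [hk]; push_cast; ring
      exact_mod_cast this
    have hbez : (p : ℝ) * p.gcdA q + q * p.gcdB q = 1 := by
      have := Nat.gcd_eq_gcd_ab p q
      rw [hpq.gcd_eq_one] at this
      exact_mod_cast this.symm
    have hp' : (p : ℝ) ≠ 0 := by exact_mod_cast hp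
    -- The orbit angle must give the arguments of `a` and `b` simultaneously modulo `2π`. Shifting
    -- `arg a` by `k * gcdB` turns, by Bézout, into a shift of `arg b` by `-k * gcdA`.
    refine ⟨((arg a + (k * p.gcdB q : ℤ) * (2 * Real.pi)) / p, φ, ‖b‖ ^ 2),
      ⟨trivial, hφ, by positivity, ?_⟩, Prod.ext ?_ ?_⟩
    · change ‖b‖ ^ 2 < 2
      have : 0 < ‖a‖ ^ 2 := by positivity
      linarith
    · dsimp only [toricPoint]
      rw [← eq_sub_of_add_eq hab, Real.sqrt_sq hna.le, mul_div_cancel₀ _ hp']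
      conv_rhs => rw [← norm_mul_exp_arg_mul_I a]
      congr 1
      exact exp_eq_exp_iff_exists_int.2 ⟨k * p.gcdB q, by push_cast; ring⟩
    · dsimp only [toricPoint]
      rw [Real.sqrt_sq hnb.le]
      conv_rhs => rw [← norm_mul_exp_arg_mul_I b]
      congr 1
      refine exp_eq_exp_iff_exists_int.2 ⟨-(k * p.gcdA q), ?_⟩
      have : q * ((arg a + (k * p.gcdB q : ℤ) * (2 * Real.pi)) / p) + φ / p =
          arg b + (-(k * p.gcdA q) : ℤ) * (2 * Real.pi) := by
        field_simp
        push_cast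
        linear_combination -hk' + 2 * Real.pi * k * hbez
      rw [this]
      push_cast
      ring
  · rintro ⟨x, ⟨-, hφ, hr⟩, rfl⟩
    have h1 : 0 < √(2 - x.2.2) := Real.sqrt_pos.2 (by linarith [hr.2])
    have h2 : 0 < √x.2.2 := Real.sqrt_pos.2 hr.1
    have ha : (toricPoint p q x).1 ≠ 0 := mul_ne_zero (by exact_mod_cast h1.ne') (exp_ne_zero _)
    have hb : (toricPoint p q x).2 ≠ 0 := mul_ne_zero (by exact_mod_cast h2.ne') (exp_ne_zero _)
    have hs : -((toricPoint p q x).2 ^ p / (toricPoint p q x).1 ^ q) ∈ slitPlane := by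
      rw [toricPoint_div hp]
      exact neg_real_mul_exp_mem_slitPlane (by positivity) hφ
    refine ⟨⟨toricPoint p q x, ?_, fun h => ?_⟩, (mem_slitDomain_inter_iff _).2 ⟨ha, hb, hs⟩, rfl⟩
    · rw [toricPoint, norm_mul, norm_mul, norm_exp_ofReal_mul_I, norm_exp_ofReal_mul_I, norm_real,
        norm_real, mul_one, mul_one, Real.norm_of_nonneg h1.le, Real.norm_of_nonneg h2.le,
        Real.sq_sqrt (by linarith [hr.2]), Real.sq_sqrt hr.1.le]
      ring
    · rw [← h, div_self (pow_ne_zero _ ha)] at hs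
      simp [mem_slitPlane_iff] at hs
      linarith

theorem isPathConnected_slitDomain_inter {p q : ℕ} (hp : p ≠ 0) (hpq : p.Coprime q) :
    IsPathConnected
      (slitDomain p q ∩ TorusKnotComplement.swap p q ⁻¹' slitDomain q p) := by
  refine (Topology.IsInducing.isPathConnected_iff (f := Subtype.val) ⟨rfl⟩).2 ?_
  rw [image_slitDomain_inter hp hpq]
  refine IsPathConnected.image (Convex.isPathConnected ?_ ?_) ?_
  · exact convex_univ.prod ((convex_Ioo _ _).prod (convex_Ioo _ _))
  · exact ⟨(0, Real.pi, 1), trivial, ⟨Real.pi_pos, by linarith [Real.pi_pos]⟩,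
      ⟨one_pos, one_lt_two⟩⟩
  · unfold toricPoint
    fun_prop

theorem isPathConnected_swap_preimage_slitDomain (p : ℕ) {q : ℕ} (hq : q ≠ 0) :
    IsPathConnected (TorusKnotComplement.swap p q ⁻¹' slitDomain q p) := by
  rw [← Homeomorph.image_symm]
  exact (isPathConnected_slitDomain hq p).image (Homeomorph.continuous _)

theorem TorusKnotComplement.pathConnectedSpace {p q : ℕ} (hp : p ≠ 0) (hq : q ≠ 0)
    (hpq : p.Coprime q) : PathConnectedSpace (TorusKnotComplement p q) := by
  rw [pathConnectedSpace_iff_univ, ← slitDomain_union p q hp hq]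
  exact (isPathConnected_slitDomain hp q).union (isPathConnected_swap_preimage_slitDomain p hq)
    (isPathConnected_slitDomain_inter hp hpq).nonempty

theorem TorusKnotComplement.fg_fundamentalGroup {p q : ℕ} (hp : p ≠ 0) (hq : q ≠ 0)
    (hpq : p.Coprime q) (x₀ : TorusKnotComplement p q) :
    Group.FG (FundamentalGroup (TorusKnotComplement p q) x₀) := by
  have := TorusKnotComplement.pathConnectedSpace hp hq hpq
  have := simplyConnectedSpace_slitCover hp q
  have := simplyConnectedSpace_slitCover hq p
  obtain ⟨y₀, hy₀⟩ := (isPathConnected_slitDomain_inter hp hpq).nonempty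
  obtain ⟨e, he⟩ : y₀ ∈ Set.range (slitCoverMap hp q) := range_slitCoverMap hp q ▸ hy₀.1
  obtain ⟨e', he'⟩ : swap p q y₀ ∈ Set.range (slitCoverMap hq p) :=
    range_slitCoverMap hq p ▸ hy₀.2
  obtain ⟨g, hg⟩ := FundamentalGroup.exists_mem_zpowers_of_lift (slitCoverMap hp q)
    (slitCoverDeck hp q) (slitCoverDeck_one hp q) (slitCoverDeck_mul hp q)
    (slitCoverMap_deck hp q) he
  obtain ⟨g', hg'⟩ := FundamentalGroup.exists_mem_zpowers_of_lift
    (ContinuousMap.comp ⟨swap q p, (swap q p).continuous⟩ (slitCoverMap hq p))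
    (slitCoverDeck hq p) (slitCoverDeck_one hq p) (slitCoverDeck_mul hq p)
    (fun n x => congrArg (swap q p) (slitCoverMap_deck hq p n x))
    (e := e') (x₀ := y₀) (congrArg (swap q p) he')
  have hfg : Group.FG (FundamentalGroup (TorusKnotComplement p q) y₀) := by
    refine Group.fg_iff.2 ⟨{g, g'}, ?_, Set.toFinite _⟩
    refine FundamentalGroup.eq_top_of_open_cover (isOpen_slitDomain p q)
      ((isOpen_slitDomain q p).preimage (swap p q).continuous) (slitDomain_union p q hp hq)
      (isPathConnected_slitDomain hp q) (isPathConnected_swap_preimage_slitDomain p hq)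
      (isPathConnected_slitDomain_inter hp hpq) hy₀ _ (fun γ hγ => ?_) fun γ hγ => ?_
    · obtain ⟨n, Γ, h⟩ := exists_path_slitCover_lift hp he γ hγ
      exact Subgroup.zpowers_le.2 (Subgroup.subset_closure (by simp))
        (hg n γ Γ fun t => (h t).symm)
    · obtain ⟨n, Γ, h⟩ := exists_path_slitCover_lift hq he' (γ.map (swap p q).continuous) (by
        rintro _ ⟨t, rfl⟩
        exact hγ ⟨t, rfl⟩)
      exact Subgroup.zpowers_le.2 (Subgroup.subset_closure (by simp))
        (hg' n γ Γ fun t => congrArg (swap q p) (h t).symm)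
  exact Group.fg_of_surjective
    (f := (FundamentalGroup.fundamentalGroupMulEquivOfPathConnected y₀ x₀).toMonoidHom)
    (FundamentalGroup.fundamentalGroupMulEquivOfPathConnected y₀ x₀).surjective

end TorusKnotComplement

/-! ### The circle action, and comparison with the knot in the sphere. -/

section TorusKnot

open Complex

theorem FundamentalGroup.fg_of_homeomorph {X Y : Type*} [TopologicalSpace X] [TopologicalSpace Y]
    (Φ : X ≃ₜ Y) (x₀ : X) [Group.FG (FundamentalGroup Y (Φ x₀))] :
    Group.FG (FundamentalGroup X x₀) := by
  refine Group.fg_of_surjective (f := FundamentalGroup.mapOfEq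
    (⟨Φ.symm, Φ.symm.continuous⟩ : C(Y, X)) (Φ.symm_apply_apply x₀)) fun g => ?_
  obtain ⟨γ, rfl⟩ := Path.Homotopic.Quotient.mk_surjective g
  refine ⟨fromPath (.mk (γ.map Φ.continuous)), ?_⟩
  rw [FundamentalGroup.mapOfEq_apply]
  refine congrArg Path.Homotopic.Quotient.mk (a₁ := ((γ.map Φ.continuous).map
    Φ.symm.continuous).cast _ _) (Path.ext (funext fun t => Φ.symm_apply_apply (γ t)))

/-- The action of the circle on the complement of a torus knot, as a homotopy. -/
def TorusKnotComplement.rotation (p q : ℕ) :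
    (ContinuousMap.id (TorusKnotComplement p q)).Homotopy (ContinuousMap.id _) where
  toFun x := ⟨(exp ((p * (2 * Real.pi * x.1) : ℝ) * I) * x.2.1.1,
      exp ((q * (2 * Real.pi * x.1) : ℝ) * I) * x.2.1.2), by
    refine ⟨?_, fun h => x.2.2.2 ?_⟩
    · simp only [norm_mul, norm_exp_ofReal_mul_I, one_mul]
      exact x.2.2.1
    · have h' : exp ((p * (2 * Real.pi * x.1) : ℝ) * I) ^ q =
          exp ((q * (2 * Real.pi * x.1) : ℝ) * I) ^ p := by
        rw [← exp_nat_mul, ← exp_nat_mul]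
        push_cast
        ring_nf
      dsimp only at h
      rw [mul_pow, mul_pow, h'] at h
      exact mul_left_cancel₀ (pow_ne_zero _ (exp_ne_zero _)) h⟩
  continuous_toFun := by fun_prop
  map_zero_left v := by ext <;> simp
  map_one_left v := by
    have h : ∀ n : ℕ, exp ((n * (2 * Real.pi * (1 : unitInterval)) : ℝ) * I) = 1 := fun n =>
      exp_eq_one_iff.2 ⟨n, by push_cast; ring⟩
    refine Subtype.ext (Prod.ext ?_ ?_)
    · change exp _ * v.1.1 = v.1.1
      rw [h, one_mul]
    · change exp _ * v.1.2 = v.1.2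
      rw [h, one_mul]

/-- The argument of the defining equation `a ^ q - b ^ p` of a torus knot. -/
def TorusKnotComplement.toCircle (p q : ℕ) : C(TorusKnotComplement p q, Circle) where
  toFun v := ⟨(v.1.1 ^ q - v.1.2 ^ p) / (‖v.1.1 ^ q - v.1.2 ^ p‖ : ℝ), by
    change _ ∈ Metric.sphere (0 : ℂ) 1
    rw [mem_sphere_zero_iff_norm, norm_div, norm_real, norm_norm, div_self]
    exact norm_ne_zero_iff.2 (sub_ne_zero.2 v.2.2)⟩
  continuous_toFun := by
    refine Continuous.subtype_mk (Continuous.div (by fun_prop) (by fun_prop) fun v => ?_) _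
    exact_mod_cast norm_ne_zero_iff.2 (sub_ne_zero.2 v.2.2)

theorem TorusKnotComplement.toCircle_rotation (p q : ℕ) (t : unitInterval)
    (v : TorusKnotComplement p q) :
    toCircle p q (rotation p q (t, v)) =
      Circle.exp ((p * q : ℕ) * (2 * Real.pi) * t) * toCircle p q v := by
  have h1 : exp ((p * (2 * Real.pi * t) : ℝ) * I) ^ q =
      exp (((p * q : ℕ) * (2 * Real.pi) * t : ℝ) * I) := by
    rw [← exp_nat_mul]; push_cast; ring_nf
  have h2 : exp ((q * (2 * Real.pi * t) : ℝ) * I) ^ p =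
      exp (((p * q : ℕ) * (2 * Real.pi) * t : ℝ) * I) := by
    rw [← exp_nat_mul]; push_cast; ring_nf
  refine Circle.ext ?_
  change ((exp ((p * (2 * Real.pi * t) : ℝ) * I) * v.1.1) ^ q -
      (exp ((q * (2 * Real.pi * t) : ℝ) * I) * v.1.2) ^ p) /
      (‖(exp ((p * (2 * Real.pi * t) : ℝ) * I) * v.1.1) ^ q -
      (exp ((q * (2 * Real.pi * t) : ℝ) * I) * v.1.2) ^ p‖ : ℝ) =
    exp (((p * q : ℕ) * (2 * Real.pi) * t : ℝ) * I) *
      ((v.1.1 ^ q - v.1.2 ^ p) / (‖v.1.1 ^ q - v.1.2 ^ p‖ : ℝ))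
  rw [mul_pow, mul_pow, h1, h2, ← mul_sub, norm_mul, norm_exp_ofReal_mul_I, one_mul, mul_div_assoc]

/-- The equation puts `‖a‖` and `‖b‖` on the same side of `1`, and their squares sum to `2`. -/
theorem norm_eq_one_of_pow_eq_pow {p q : ℕ} (hp : p ≠ 0) (hq : q ≠ 0) {a b : ℂ}
    (hab : ‖a‖ ^ 2 + ‖b‖ ^ 2 = 2) (h : a ^ q = b ^ p) : ‖a‖ = 1 ∧ ‖b‖ = 1 := by
  have h' : ‖a‖ ^ q = ‖b‖ ^ p := by rw [← norm_pow, ← norm_pow, h]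
  have ha := norm_nonneg a
  have hb := norm_nonneg b
  have : ‖a‖ = 1 := by
    rcases lt_trichotomy ‖a‖ 1 with h1 | h1 | h1
    · have h2 : ‖b‖ < 1 := by
        rw [← pow_lt_one_iff_of_nonneg hb hp, ← h']
        exact pow_lt_one₀ ha h1 hq
      nlinarith
    · exact h1
    · have h2 : 1 < ‖b‖ := by
        rw [← one_lt_pow_iff_of_nonneg hb hp, ← h']
        exact one_lt_pow₀ h1 hq
      nlinarith
  refine ⟨this, ?_⟩
  nlinarith

theorem exists_angle_of_pow_eq_pow {p q : ℕ} (hp : p ≠ 0) (hq : q ≠ 0) (hpq : p.Coprime q) {a b : ℂ}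
    (hab : ‖a‖ ^ 2 + ‖b‖ ^ 2 = 2) (h : a ^ q = b ^ p) :
    ∃ θ : ℝ, a = exp (p * θ * I) ∧ b = exp (q * θ * I) := by
  obtain ⟨ha, hb⟩ := norm_eq_one_of_pow_eq_pow hp hq hab h
  have ha' : exp (arg a * I) = a := by simpa [ha] using norm_mul_exp_arg_mul_I a
  have hb' : exp (arg b * I) = b := by simpa [hb] using norm_mul_exp_arg_mul_I b
  have hexp : exp ((q * arg a : ℝ) * I) = exp ((p * arg b : ℝ) * I) := by
    rw [← ha', ← hb', ← exp_nat_mul, ← exp_nat_mul, ← mul_assoc, ← mul_assoc] at h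
    push_cast
    exact h
  obtain ⟨k, hk⟩ := exp_eq_exp_iff_exists_int.1 hexp
  have hk' : q * arg a = p * arg b + k * (2 * Real.pi) := by
    have : ((q * arg a : ℝ) : ℂ) = (p * arg b + k * (2 * Real.pi) : ℝ) := by
      refine mul_right_cancel₀ I_ne_zero ?_
      rw [hk]; push_cast; ring
    exact_mod_cast this
  have hbez : (p : ℝ) * p.gcdA q + q * p.gcdB q = 1 := by
    have := Nat.gcd_eq_gcd_ab p q
    rw [hpq.gcd_eq_one] at this
    exact_mod_cast this.symm
  have hp' : (p : ℝ) ≠ 0 := by exact_mod_cast hp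
  -- Bézout again: this shift of `arg a` makes `q * θ` agree with `arg b` modulo `2π`.
  let θ : ℝ := (arg a - (k * p.gcdB q : ℤ) * (2 * Real.pi)) / p
  have h1 : p * θ = arg a - (k * p.gcdB q : ℤ) * (2 * Real.pi) := mul_div_cancel₀ _ hp'
  have h2 : q * θ = arg b + (k * p.gcdA q : ℤ) * (2 * Real.pi) := by
    refine mul_left_cancel₀ hp' ?_
    rw [mul_left_comm, h1]
    push_cast
    linear_combination hk' - 2 * Real.pi * k * hbez
  refine ⟨θ, ?_, ?_⟩
  · conv_lhs => rw [← ha']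
    have : (p * θ : ℂ) = (p * θ : ℝ) := by push_cast; rfl
    rw [this, h1]
    exact exp_eq_exp_iff_exists_int.2 ⟨k * p.gcdB q, by push_cast; ring⟩
  · conv_lhs => rw [← hb']
    have : (q * θ : ℂ) = (q * θ : ℝ) := by push_cast; rfl
    rw [this, h2]
    exact exp_eq_exp_iff_exists_int.2 ⟨-(k * p.gcdA q), by push_cast; ring⟩

theorem ofReal_sqrt_two_ne_zero : ((√2 : ℝ) : ℂ) ≠ 0 := by simp

theorem norm_sqrt_two_mul_sq (z : ℂ) : ‖((√2 : ℝ) : ℂ) * z‖ ^ 2 = 2 * ‖z‖ ^ 2 := by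
  rw [norm_mul, mul_pow, norm_real, Real.norm_of_nonneg (Real.sqrt_nonneg 2),
    Real.sq_sqrt zero_le_two]

theorem S3.norm_sq_add_norm_sq (x : S3) : ‖x.1 0‖ ^ 2 + ‖x.1 1‖ ^ 2 = 1 := by
  have h := x.2
  rw [mem_sphere_zero_iff_norm] at h
  have h' := EuclideanSpace.norm_sq_eq x.1
  rw [h, Fin.sum_univ_two] at h'
  linarith

theorem mem_standardTorusKnot_iff {p q : ℕ} (hp : p ≠ 0) (hq : q ≠ 0) (hpq : p.Coprime q) (x : S3) :
    x ∈ standardTorusKnot p q ↔ ((√2 : ℝ) * x.1 0 : ℂ) ^ q = ((√2 : ℝ) * x.1 1 : ℂ) ^ p := by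
  constructor
  · rintro ⟨θ, h0, h1⟩
    rw [h0, h1, mul_div_cancel₀ _ ofReal_sqrt_two_ne_zero,
      mul_div_cancel₀ _ ofReal_sqrt_two_ne_zero, ← exp_nat_mul, ← exp_nat_mul]
    ring_nf
  · intro h
    obtain ⟨θ, h0, h1⟩ := exists_angle_of_pow_eq_pow hp hq hpq (by
      rw [norm_sqrt_two_mul_sq, norm_sqrt_two_mul_sq, ← mul_add, S3.norm_sq_add_norm_sq,
        mul_one]) h
    exact ⟨θ, by rw [← h0, mul_div_cancel_left₀ _ ofReal_sqrt_two_ne_zero],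
      by rw [← h1, mul_div_cancel_left₀ _ ofReal_sqrt_two_ne_zero]⟩

/-- The complement of the standard torus knot, rescaled. -/
def standardTorusKnotComplHomeomorph {p q : ℕ} (hp : p ≠ 0) (hq : q ≠ 0) (hpq : p.Coprime q) :
    ((standardTorusKnot p q)ᶜ : Set S3) ≃ₜ TorusKnotComplement p q where
  toFun x := ⟨((√2 : ℝ) * x.1.1 0, (√2 : ℝ) * x.1.1 1), by
    rw [norm_sqrt_two_mul_sq, norm_sqrt_two_mul_sq, ← mul_add, S3.norm_sq_add_norm_sq, mul_one],
    fun h => x.2 ((mem_standardTorusKnot_iff hp hq hpq _).2 h)⟩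
  invFun v := ⟨⟨!₂[v.1.1 / (√2 : ℝ), v.1.2 / (√2 : ℝ)], by
      rw [mem_sphere_zero_iff_norm, ← sq_eq_sq₀ (norm_nonneg _) zero_le_one,
        EuclideanSpace.norm_sq_eq, Fin.sum_univ_two]
      have h := v.2.1
      have h' : √2 ^ 2 = 2 := Real.sq_sqrt zero_le_two
      simp only [Matrix.cons_val_zero, Matrix.cons_val_one, norm_div, norm_real,
        Real.norm_of_nonneg (Real.sqrt_nonneg 2), div_pow, h']
      linarith⟩, fun h => v.2.2 (by
        have := (mem_standardTorusKnot_iff hp hq hpq _).1 h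
        simpa [mul_div_cancel₀] using this)⟩
  left_inv x := by
    refine Subtype.ext (Subtype.ext ?_)
    ext i
    fin_cases i <;> simp
  right_inv v := by
    ext <;> simp [mul_div_cancel₀]
  continuous_toFun := by fun_prop
  continuous_invFun := by
    refine Continuous.subtype_mk (Continuous.subtype_mk ?_ _) _
    refine (PiLp.continuous_toLp 2 _).comp (continuous_pi fun i => ?_)
    fin_cases i
    · exact Continuous.div_const (by fun_prop) _
    · exact Continuous.div_const (by fun_prop) _

theorem IsTorusKnot.exists_homeomorph {K : Set S3} (hK : IsTorusKnot K) :
    ∃ p q : ℕ, p ≠ 0 ∧ q ≠ 0 ∧ p.Coprime q ∧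
      Nonempty ((Kᶜ : Set S3) ≃ₜ TorusKnotComplement p q) := by
  obtain ⟨p, q, hp, hq, hpq, h, rfl⟩ := hK
  refine ⟨p, q, hp.ne', hq.ne', hpq, ⟨?_⟩⟩
  refine Homeomorph.trans ?_ (standardTorusKnotComplHomeomorph hp.ne' hq.ne' hpq)
  exact (Homeomorph.setCongr (Set.image_compl_eq h.bijective).symm).trans (h.image _).symm

theorem IsTorusKnot.fg_knotGroup {K : Set S3} (hK : IsTorusKnot K) (x₀ : (Kᶜ : Set S3)) :
    Group.FG (KnotGroup K x₀) := by
  obtain ⟨p, q, hp, hq, hpq, ⟨Φ⟩⟩ := hK.exists_homeomorph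
  have := TorusKnotComplement.fg_fundamentalGroup hp hq hpq (Φ x₀)
  exact FundamentalGroup.fg_of_homeomorph Φ x₀

theorem IsTorusKnot.exists_mem_center {K : Set S3} (hK : IsTorusKnot K) (x₀ : (Kᶜ : Set S3))
    (e : Abelianization (KnotGroup K x₀) ≃* Multiplicative ℤ) :
    ∃ z ∈ Subgroup.center (KnotGroup K x₀), abelianizationHom e z ≠ 1 := by
  obtain ⟨p, q, hp, hq, hpq, ⟨Φ⟩⟩ := hK.exists_homeomorph
  -- The circle action transported to the complement of `K`; the winding number of its orbits is `p
  -- * q`.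
  let H : (ContinuousMap.id (Kᶜ : Set S3)).Homotopy (ContinuousMap.id _) :=
    { toFun := fun x => Φ.symm (TorusKnotComplement.rotation p q (x.1, Φ x.2))
      continuous_toFun := by fun_prop
      map_zero_left := fun x => by simp
      map_one_left := fun x => by simp }
  refine ⟨_, H.loop_mem_center x₀, H.abelianizationHom_loop_ne_one
    ((TorusKnotComplement.toCircle p q).comp ⟨Φ, Φ.continuous⟩) (n := (p * q : ℕ))
    (by exact_mod_cast mul_ne_zero hp hq) (fun t x => ?_) x₀ e⟩
  change TorusKnotComplement.toCircle p q (Φ (Φ.symm _)) = _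
  rw [Φ.apply_symm_apply, TorusKnotComplement.toCircle_rotation]
  rfl

end TorusKnot

end

theorem mainTheorem9 (K : Set S3) (hK : IsTorusKnot K) (x₀ : (Kᶜ : Set S3))
    (e : Abelianization (KnotGroup K x₀) ≃* Multiplicative ℤ)
    (N : ℕ) (γ : KnotGroup K x₀ →* GL (Fin N) ℤ) (hγ : IsPermutationRepresentation γ) :
    (∃ Δ : ℤ[T;T⁻¹], IsTwistedAlexanderPolynomial γ (abelianizationHom e) Δ) ∧
    ∀ Δ : ℤ[T;T⁻¹], IsTwistedAlexanderPolynomial γ (abelianizationHom e) Δ →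
      IsProductOfCyclotomics Δ := by
  have := hK.fg_knotGroup x₀
  obtain ⟨z, hz, hε⟩ := hK.exists_mem_center x₀ e
  exact isProductOfCyclotomics_of_mem_center hγ hz hε
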